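/- Let $n>2$ and let $\mathbb E_1^{n+2}$ be $\mathbb R^{n+2}$ with the metric $\langle x,y\rangle=-x_1y_1+x_2y_2+\dots+x_{n+2}y_{n+2}$. Let $\mathcal{LC}^n\times\mathbb R=\{x\in\mathbb R^{n+2}: -x_1^2+x_2^2+\dots+x_{n+1}^2=0,\ x_1>0\}$. Let $M$ be an $n$-dimensional smooth non-degenerate (immersed) submanifold of $\mathbb E_1^{n+2}$ with position vector $\phi$ and second fundamental form $h$, lying on $\mathcal{LC}^n\times\mathbb R$, and assume that the constant vector field $\partial_{x_{n+2}}$ is not tangent to $M$ at any point of $M$. Then the following are equivalent. (1) $M$ is $\lambda$-isotropic for some $\lambda\in C^\infty(M)$, that is, $\langle h(X,X),h(X,X)\rangle=\lambda$ for every unit vector $X$ tangent to $M$. (2) Every point of $M$ has a neighborhood in $M$ which is congruent to the submanifold parametrized by $$(s,t)\mapsto\big(\epsilon s+c_0,\ (\epsilon s+c_0)\Theta_1(t),\ \dots,\ (\epsilon s+c_0)\Theta_n(t),\ s\big),\qquad t=(t_2,\dots,t_n),$$ for some $\epsilon\in\{1,-1\}$ and some constant $c_0\in\mathbb R$, where $\Theta=(\Theta_1,\dots,\Theta_n)$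 is a local parametrization of the unit hypersphere $\mathbb S^{n-1}$ of $\mathbb E^n$. That is, there are a rotation $\mathbf Q$ of the hyperplane $x_{n+2}=0$ (a linear isometry of $\mathbb E_1^{n+1}$ preserving the orientation and the time orientation, extended to $\mathbb E_1^{n+2}$ so as to fix $x_{n+2}$) and smooth local coordinates $(s,t)$ on the neighborhood, ranging over the product of an open interval and an open subset of $\mathbb R^{n-1}$, in which $\mathbf Q\circ\phi$ is the map above. -/

import Mathlib

open scoped Manifold ContDiff

noncomputable section

/-- The Minkowski metric `⟨x, y⟩ = - x₀ y₀ + ∑_{i ≥ 1} xᵢ yᵢ` of the Minkowski space `𝔼₁^{m+1}`. The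
underlying vector space is `Fin (m + 1) → ℝ`, whose coordinates are `x 0` (time), `x 1`, …, `x m`;
the sup norm of Mathlib on it serves only for its topology and for differentiation. -/
def minkForm (m : ℕ) : LinearMap.BilinForm ℝ (Fin (m + 1) → ℝ) :=
  LinearMap.mk₂ ℝ (fun x y => -(x 0 * y 0) + ∑ i : Fin m, x i.succ * y i.succ)
    (fun x y z => by simp only [Pi.add_apply, add_mul, Finset.sum_add_distrib]; ring)
    (fun c x y => by
      simp only [Pi.smul_apply, smul_eq_mul, mul_add, Finset.mul_sum, mul_assoc, mul_neg])
    (fun x y z => by simp only [Pi.add_apply, mul_add, Finset.sum_add_distrib]; ring)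
    (fun c x y => by
      simp only [Pi.smul_apply, smul_eq_mul, mul_add, Finset.mul_sum, mul_left_comm _ c, mul_neg])

theorem minkForm_apply (m : ℕ) (x y : Fin (m + 1) → ℝ) :
    minkForm m x y = -(x 0 * y 0) + ∑ i : Fin m, x i.succ * y i.succ := rfl

theorem minkForm_isRefl (m : ℕ) : (minkForm m).IsRefl := by
  intro x y h
  rw [minkForm_apply] at h ⊢
  simpa only [mul_comm] using h

/-- The future light cone `ℒ𝒞ⁿ` of `𝔼₁^{n+1}`. -/
def futureLightCone (n : ℕ) : Set (Fin (n + 1) → ℝ) :=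
  {x | minkForm n x x = 0 ∧ 0 < x 0}

/-- The light-like hypercylinder `ℒ𝒞ⁿ × ℝ ⊆ 𝔼₁^{n+2}`: the first `n + 1` coordinates form a point
of the future light cone of `𝔼₁^{n+1}`, the last coordinate is arbitrary. -/
def lightHypercylinder (n : ℕ) : Set (Fin (n + 2) → ℝ) :=
  {x | (Fin.init x : Fin (n + 1) → ℝ) ∈ futureLightCone n}

/-- The constant vector field `∂/∂x_{n+2}` on `𝔼₁^{n+2}` (the last coordinate vector). -/
def lastDirection (n : ℕ) : Fin (n + 2) → ℝ := Pi.single (Fin.last (n + 1)) 1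

/-- The normal part of a vector `u` with respect to a subspace `T` on which the metric is
nondegenerate: the component of `u` in `T^⊥` in the decomposition `𝔼₁^{m+1} = T^⊥ ⊕ T`. -/
def normalPart {m : ℕ} (T : Submodule ℝ (Fin (m + 1) → ℝ))
    (hT : ((minkForm m).restrict T).Nondegenerate) (u : Fin (m + 1) → ℝ) : Fin (m + 1) → ℝ :=
  ((minkForm m).orthogonal T).projection T
    (LinearMap.BilinForm.isCompl_orthogonal_of_restrict_nondegenerate
      (minkForm_isRefl m) hT).symm u

section Immersion

/-- The differential `dφ_p : T_p M → 𝔼₁^{m+1}`, where `T_p M` is identified with `ℝⁿ` by the chart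
at `p`, as everywhere in Mathlib. -/
def differential (n : ℕ) {m : ℕ} {M : Type*} [TopologicalSpace M]
    [ChartedSpace (EuclideanSpace ℝ (Fin n)) M] (φ : M → Fin (m + 1) → ℝ) (p : M) :
    EuclideanSpace ℝ (Fin n) →L[ℝ] (Fin (m + 1) → ℝ) :=
  mfderiv (𝓡 n) 𝓘(ℝ, Fin (m + 1) → ℝ) φ p

/-- The tangent space of the immersed submanifold `φ : M → 𝔼₁^{m+1}` at `p`, as a subspace of
`𝔼₁^{m+1}`. -/
def imageTangent (n : ℕ) {m : ℕ} {M : Type*} [TopologicalSpace M]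
    [ChartedSpace (EuclideanSpace ℝ (Fin n)) M] (φ : M → Fin (m + 1) → ℝ) (p : M) :
    Submodule ℝ (Fin (m + 1) → ℝ) :=
  LinearMap.range (differential n φ p).toLinearMap

/-- `φ : M → 𝔼₁^{m+1}` is (the position vector of) a smooth nondegenerate immersed submanifold of
dimension `n`: a smooth immersion such that the metric is nondegenerate on every tangent space. -/
structure IsNondegenerateImmersion (n : ℕ) {m : ℕ} {M : Type*} [TopologicalSpace M]
    [ChartedSpace (EuclideanSpace ℝ (Fin n)) M] (φ : M → Fin (m + 1) → ℝ) : Prop where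
  smooth : ContMDiff (𝓡 n) 𝓘(ℝ, Fin (m + 1) → ℝ) ∞ φ
  injective : ∀ p, Function.Injective (differential n φ p)
  nondegenerate : ∀ p, ((minkForm m).restrict (imageTangent n φ p)).Nondegenerate

variable {n m : ℕ} {M : Type*} [TopologicalSpace M] [ChartedSpace (EuclideanSpace ℝ (Fin n)) M]

/-- The induced metric `⟨v, w⟩` on the tangent space `T_p M`. -/
def inducedMetric (φ : M → Fin (m + 1) → ℝ) (p : M) (v w : TangentSpace (𝓡 n) p) : ℝ :=
  minkForm m (differential n φ p v) (differential n φ p w)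

/-- The second fundamental form `h_p(v, w) = (∇̃_v W)^⊥`. Here `∇̃` is the flat connection of
`𝔼₁^{m+1}` (the directional derivative), and `w` is extended to the tangent vector field `W` with
constant components in the chart at `p`, so that `∇̃_v W` is the second derivative in the directions
`v` and `w` of the local parametrization of the submanifold that is inverse to this chart. Tangent
vectors at `p` are identified with their components in this chart. -/
def secondFundamentalForm {φ : M → Fin (m + 1) → ℝ}
    (hφ : IsNondegenerateImmersion n φ) (p : M) (v w : TangentSpace (𝓡 n) p) :
    Fin (m + 1) → ℝ :=
  normalPart (imageTangent n φ p) (hφ.nondegenerate p)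
    (fderiv ℝ (fun x : EuclideanSpace ℝ (Fin n) =>
        fderiv ℝ (φ ∘ (extChartAt (𝓡 n) p).symm) x (w : EuclideanSpace ℝ (Fin n)))
      (extChartAt (𝓡 n) p p) (v : EuclideanSpace ℝ (Fin n)))

/-- The submanifold is `lam`-isotropic: `lam` is a smooth function on `M` and
`⟨h(X, X), h(X, X)⟩ = lam` for all unit tangent vectors `X`. -/
def IsIsotropicImmersion {φ : M → Fin (m + 1) → ℝ} (hφ : IsNondegenerateImmersion n φ)
    (lam : M → ℝ) : Prop :=
  ContMDiff (𝓡 n) 𝓘(ℝ, ℝ) ∞ lam ∧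
    ∀ (p : M) (X : TangentSpace (𝓡 n) p), inducedMetric φ p X X = 1 →
      minkForm m (secondFundamentalForm hφ p X X) (secondFundamentalForm hφ p X X) = lam p

end Immersion

/-- `Q` is a rotation of `𝔼₁^{n+1}`: a linear isometry of the Minkowski metric which preserves
the orientation and the time orientation. -/
structure IsMinkowskiRotation {n : ℕ} (Q : (Fin (n + 1) → ℝ) →ₗ[ℝ] (Fin (n + 1) → ℝ)) : Prop where
  isometry : ∀ x y, minkForm n (Q x) (Q y) = minkForm n x y
  det_eq_one : LinearMap.det Q = 1
  time_orientation : 0 < Q (Pi.single 0 1) 0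

/-- The action on `𝔼₁^{n+2}` of a map of the hyperplane `x_{n+2} = 0` (identified with
`𝔼₁^{n+1}`), fixing the last coordinate. -/
def extendRotation {n : ℕ} (Q : (Fin (n + 1) → ℝ) →ₗ[ℝ] (Fin (n + 1) → ℝ))
    (x : Fin (n + 2) → ℝ) : Fin (n + 2) → ℝ :=
  Fin.snoc (α := fun _ => ℝ) (Q (Fin.init x)) (x (Fin.last (n + 1)))

/-- The point `((ε s + c₀), (ε s + c₀) Θ₁, …, (ε s + c₀) Θₙ, s)` of `𝔼₁^{n+2}`. -/
def modelPoint {n : ℕ} (ε c₀ s : ℝ) (Θ : EuclideanSpace ℝ (Fin n)) : Fin (n + 2) → ℝ :=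
  Fin.snoc (α := fun _ => ℝ) (Fin.cons (ε * s + c₀) (fun i : Fin n => (ε * s + c₀) * Θ i)) s

/-- `Θ` is a smooth local parametrization, on the open set `V ⊆ ℝ^{n-1}`, of the unit sphere
`𝕊^{n-1}` of `𝔼ⁿ`. -/
structure IsSphereParametrization {n : ℕ} (V : Set (EuclideanSpace ℝ (Fin (n - 1))))
    (Θ : EuclideanSpace ℝ (Fin (n - 1)) → EuclideanSpace ℝ (Fin n)) : Prop where
  isOpen : IsOpen V
  smooth : ContDiffOn ℝ ∞ Θ V
  injOn : Set.InjOn Θ V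
  immersion : ∀ t ∈ V, Function.Injective (fderiv ℝ Θ t)
  mem_sphere : ∀ t ∈ V, Θ t ∈ Metric.sphere (0 : EuclideanSpace ℝ (Fin n)) 1

/-- Some open neighborhood of `p` in the submanifold `φ : M → 𝔼₁^{n+2}` is congruent, by a rotation
of the hyperplane `x_{n+2} = 0`, to the submanifold parametrized by
`(s, t) ↦ ((ε s + c₀), (ε s + c₀) Θ(t), s)`, where `ε = ±1`, `c₀` is a constant and `Θ` is a
local parametrization of the unit sphere. The map `F` is the inverse of the coordinate system
`(s, t)` on this neighborhood, which is `F.target`. -/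
def LocallyCongruentToModel {n : ℕ} {M : Type*} [TopologicalSpace M]
    [ChartedSpace (EuclideanSpace ℝ (Fin n)) M] (φ : M → Fin (n + 2) → ℝ) (p : M) : Prop :=
  ∃ (Q : (Fin (n + 1) → ℝ) →ₗ[ℝ] (Fin (n + 1) → ℝ)) (ε c₀ a b : ℝ)
    (V : Set (EuclideanSpace ℝ (Fin (n - 1))))
    (Θ : EuclideanSpace ℝ (Fin (n - 1)) → EuclideanSpace ℝ (Fin n))
    (F : OpenPartialHomeomorph (ℝ × EuclideanSpace ℝ (Fin (n - 1))) M),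
    IsMinkowskiRotation Q ∧ (ε = 1 ∨ ε = -1) ∧ IsSphereParametrization V Θ ∧
    p ∈ F.target ∧ F.source = Set.Ioo a b ×ˢ V ∧
    ContMDiffOn 𝓘(ℝ, ℝ × EuclideanSpace ℝ (Fin (n - 1))) (𝓡 n) ∞ F F.source ∧
    ContMDiffOn (𝓡 n) 𝓘(ℝ, ℝ × EuclideanSpace ℝ (Fin (n - 1))) ∞ F.symm F.target ∧
    ∀ s ∈ Set.Ioo a b, ∀ t ∈ V,
      extendRotation Q (φ (F (s, t))) = modelPoint ε c₀ s (Θ t)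

end

/-! ### The Minkowski form -/

/-! At a point of M let T be the tangent space and η the position vector with its last coordinate
replaced by zero (`coneNormal`). Then η is null and normal to T, so the normal plane has a null
frame η, ξ with ⟨ξ, η⟩ = -1, and every normal u satisfies ⟨u, u⟩ = -2⟨u, ξ⟩⟨u, η⟩.

Let S be the second derivative of φ and A = ⟨S, ξ⟩. Differentiating ⟨X, η⟩ = 0 gives ⟨S(X, X), η⟩ =
-P(X, X), where P(X, X) = ⟨X, X⟩ - (X_{n+2})². This P is positive semidefinite because T is
orthogonal to η. Hence ⟨h(X, X), h(X, X)⟩ = 2 A(X, X) P(X, X). The tangential part of ∂/∂x_{n+2} is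
a unit vector at which P vanishes, so an isotropic M has λ = 0. Thus A vanishes wherever P is
positive. As P is not identically zero for n ≥ 2, polarization yields A = 0
(`minkForm_eq_zero_of_isotropic`).

Vanishing of A makes the derivative of ξ normal; being orthogonal to ξ as well, it is a multiple of
ξ. So the line spanned by ξ is parallel. Since ∂/∂x_{n+2} is not tangent, the last coordinate of ξ
is nonzero, and scaling it to 1 gives a locally constant null normal N (`exists_const_null_normal`).
Then ⟨φ, N⟩ is locally constant. The first n + 1 coordinates of N form a unit time-like vector;
rotating it, up to sign, to the time axis turns this relation into x₁ = ε x_{n+2} + c₀. Together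
with the cone equation this is the model, with coordinates given by x_{n+2} and the direction on the
sphere.

Conversely, the model satisfies ⟨φ, N⟩ = const for a constant null N transverse to η. Hence ξ is
proportional to N, A = 0, and M is isotropic with λ = 0. -/

theorem minkForm_comm (m : ℕ) (x y : Fin (m + 1) → ℝ) : minkForm m x y = minkForm m y x := by
  simp only [minkForm_apply, mul_comm]

theorem minkForm_nondegenerate (m : ℕ) : (minkForm m).Nondegenerate := by
  have key : ∀ x, (∀ y, minkForm m x y = 0) → x = 0 := by
    intro x hx
    funext i
    refine Fin.cases ?_ (fun j => ?_) i
    · simpa [minkForm_apply] using hx (Pi.single 0 1)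
    · simpa [minkForm_apply, Pi.single_apply] using hx (Pi.single j.succ 1)
  exact ⟨key, fun y hy => key y fun x => by rw [minkForm_comm]; exact hy x⟩

theorem minkForm_eq_init_add_last (n : ℕ) (x y : Fin (n + 2) → ℝ) :
    minkForm (n + 1) x y = minkForm n (Fin.init x : Fin (n + 1) → ℝ) (Fin.init y) +
      x (Fin.last (n + 1)) * y (Fin.last (n + 1)) := by
  simp only [minkForm_apply, Fin.sum_univ_castSucc, Fin.init, Fin.castSucc_zero, Fin.succ_last,
    Fin.succ_castSucc]
  ring

/-- A vector orthogonal to a nonzero null vector is space-like or null. -/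
theorem minkForm_self_nonneg_of_orthogonal {n : ℕ} {x y : Fin (n + 1) → ℝ}
    (hy : y ∈ futureLightCone n) (hxy : minkForm n x y = 0) : 0 ≤ minkForm n x x := by
  obtain ⟨h1, h2⟩ := hy
  rw [minkForm_apply] at h1 hxy ⊢
  have hcs := Finset.sum_mul_sq_le_sq_mul_sq Finset.univ (fun i : Fin n => x i.succ)
    (fun i => y i.succ)
  simp only [pow_two] at hcs
  have e1 : ∑ i : Fin n, x i.succ * y i.succ = x 0 * y 0 := by linarith
  have e2 : ∑ i : Fin n, y i.succ * y i.succ = y 0 * y 0 := by linarith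
  rw [e1, e2] at hcs
  have : (x 0 * x 0) * (y 0 * y 0) ≤ (∑ i : Fin n, x i.succ * x i.succ) * (y 0 * y 0) := by
    linarith
  linarith [le_of_mul_le_mul_right this (mul_pos h2 h2)]

/-- The linear map which replaces the last coordinate by zero. At a point of the light-like
hypercylinder it gives the null normal vector of the hypercylinder. -/
noncomputable def coneNormal (n : ℕ) : (Fin (n + 2) → ℝ) →L[ℝ] (Fin (n + 2) → ℝ) :=
  ContinuousLinearMap.id ℝ _ -
    (ContinuousLinearMap.proj (R := ℝ) (φ := fun _ : Fin (n + 2) => ℝ)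
      (Fin.last (n + 1))).smulRight (lastDirection n)

theorem coneNormal_apply (n : ℕ) (x : Fin (n + 2) → ℝ) :
    coneNormal n x = x - x (Fin.last (n + 1)) • lastDirection n := rfl

theorem coneNormal_last (n : ℕ) (x : Fin (n + 2) → ℝ) : coneNormal n x (Fin.last (n + 1)) = 0 := by
  simp [coneNormal_apply, lastDirection]

theorem coneNormal_zero (n : ℕ) (x : Fin (n + 2) → ℝ) : coneNormal n x 0 = x 0 := by
  have : (0 : Fin (n + 2)) ≠ Fin.last (n + 1) := (Fin.last_pos).ne
  simp [coneNormal_apply, lastDirection, this]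

theorem init_coneNormal (n : ℕ) (x : Fin (n + 2) → ℝ) :
    (Fin.init (coneNormal n x) : Fin (n + 1) → ℝ) = Fin.init x := by
  funext i
  have : i.castSucc ≠ Fin.last (n + 1) := (Fin.castSucc_lt_last i).ne
  simp [Fin.init, coneNormal_apply, lastDirection, this]

theorem minkForm_lastDirection (n : ℕ) (x : Fin (n + 2) → ℝ) :
    minkForm (n + 1) x (lastDirection n) = x (Fin.last (n + 1)) := by
  have h : (Fin.init (lastDirection n) : Fin (n + 1) → ℝ) = 0 := by
    funext i
    have : i.castSucc ≠ Fin.last (n + 1) := (Fin.castSucc_lt_last i).ne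
    simp [Fin.init, lastDirection, this]
  rw [minkForm_eq_init_add_last, h]
  simp [lastDirection]

theorem minkForm_coneNormal (n : ℕ) (x y : Fin (n + 2) → ℝ) :
    minkForm (n + 1) x (coneNormal n y) =
      minkForm n (Fin.init x : Fin (n + 1) → ℝ) (Fin.init y) := by
  rw [minkForm_eq_init_add_last, coneNormal_last, init_coneNormal]
  ring

theorem minkForm_coneNormal_eq_sub (n : ℕ) (x y : Fin (n + 2) → ℝ) :
    minkForm (n + 1) x (coneNormal n y) =
      minkForm (n + 1) x y - x (Fin.last (n + 1)) * y (Fin.last (n + 1)) := by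
  rw [minkForm_coneNormal, minkForm_eq_init_add_last]
  ring

theorem minkForm_coneNormal_self {n : ℕ} {x : Fin (n + 2) → ℝ} (hx : x ∈ lightHypercylinder n) :
    minkForm (n + 1) (coneNormal n x) (coneNormal n x) = 0 := by
  rw [minkForm_coneNormal, init_coneNormal]
  exact hx.1

/-- The pointwise data of a nondegenerate submanifold of dimension `n` of the light-like
hypercylinder: the tangent space `T` at the point `x`. -/
structure IsHypercylinderTangent {n : ℕ} (T : Submodule ℝ (Fin (n + 2) → ℝ))
    (x : Fin (n + 2) → ℝ) : Prop where
  finrank_eq : Module.finrank ℝ T = n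
  nondegenerate : ((minkForm (n + 1)).restrict T).Nondegenerate
  mem : x ∈ lightHypercylinder n
  orthogonal : ∀ t ∈ T, minkForm (n + 1) t (coneNormal n x) = 0

/-- `ξ` is the null normal vector of `T` with `⟨ξ, η⟩ = -1`, where `η` is the null normal vector of
the hypercylinder at `x`. -/
structure IsNullNormal {n : ℕ} (T : Submodule ℝ (Fin (n + 2) → ℝ)) (x ξ : Fin (n + 2) → ℝ) :
    Prop where
  orthogonal : ∀ t ∈ T, minkForm (n + 1) t ξ = 0
  null : minkForm (n + 1) ξ ξ = 0
  pairing : minkForm (n + 1) ξ (coneNormal n x) = -1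

/-! ### Linear algebra at one point: the null frame of the normal plane. -/

namespace IsHypercylinderTangent

variable {n : ℕ} {T : Submodule ℝ (Fin (n + 2) → ℝ)} {x : Fin (n + 2) → ℝ}

theorem eq_zero_of_mem (h : IsHypercylinderTangent T x) {t : Fin (n + 2) → ℝ} (ht : t ∈ T)
    (h0 : ∀ s ∈ T, minkForm (n + 1) t s = 0) : t = 0 := by
  have := h.nondegenerate.1 ⟨t, ht⟩ (fun s => h0 s s.2)
  simpa using congrArg Subtype.val this

theorem coneNormal_ne_zero (h : IsHypercylinderTangent T x) : coneNormal n x ≠ 0 := by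
  intro h0
  have h1 : 0 < x 0 := h.mem.2
  rw [← coneNormal_zero n x, h0] at h1
  exact lt_irrefl _ h1

theorem coneNormal_notMem (h : IsHypercylinderTangent T x) : coneNormal n x ∉ T := fun hm =>
  h.coneNormal_ne_zero (h.eq_zero_of_mem hm fun s hs => by rw [minkForm_comm, h.orthogonal s hs])

/-- T ⊕ ℝη has dimension n + 1, so its orthogonal complement is a line; that line contains η because
η is null and normal to T. -/
theorem exists_eq_smul_coneNormal (h : IsHypercylinderTangent T x) {u : Fin (n + 2) → ℝ}
    (huT : ∀ t ∈ T, minkForm (n + 1) t u = 0) (hu : minkForm (n + 1) u (coneNormal n x) = 0) :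
    ∃ c : ℝ, u = c • coneNormal n x := by
  set W : Submodule ℝ (Fin (n + 2) → ℝ) := T ⊔ Submodule.span ℝ {coneNormal n x} with hW
  have hWdim : Module.finrank ℝ W = n + 1 := by
    have hinf : T ⊓ Submodule.span ℝ {coneNormal n x} = ⊥ := by
      rw [← disjoint_iff, Submodule.disjoint_span_singleton' h.coneNormal_ne_zero]
      exact h.coneNormal_notMem
    have := Submodule.finrank_sup_add_finrank_inf_eq T (Submodule.span ℝ {coneNormal n x})
    rw [hinf, finrank_bot, finrank_span_singleton h.coneNormal_ne_zero, h.finrank_eq] at this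
    simpa using this
  have hmem : ∀ v : Fin (n + 2) → ℝ, (∀ t ∈ T, minkForm (n + 1) t v = 0) →
      minkForm (n + 1) v (coneNormal n x) = 0 → v ∈ (minkForm (n + 1)).orthogonal W := by
    intro v h1 h2
    rw [LinearMap.BilinForm.mem_orthogonal_iff]
    intro w hw
    obtain ⟨t, ht, s, hs, rfl⟩ := Submodule.mem_sup.1 hw
    obtain ⟨c, rfl⟩ := Submodule.mem_span_singleton.1 hs
    rw [map_add, map_smul, LinearMap.add_apply, LinearMap.smul_apply, h1 t ht,
      minkForm_comm, h2]
    simp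
  have hdim : Module.finrank ℝ ((minkForm (n + 1)).orthogonal W) = 1 := by
    rw [LinearMap.BilinForm.finrank_orthogonal (minkForm_nondegenerate _), hWdim]
    simp
  have hη := hmem _ h.orthogonal (minkForm_coneNormal_self h.mem)
  obtain ⟨c, hc⟩ := (finrank_eq_one_iff_of_nonzero'
    (⟨coneNormal n x, hη⟩ : (minkForm (n + 1)).orthogonal W)
    (fun h0 => h.coneNormal_ne_zero (congrArg Subtype.val h0))).1 hdim ⟨u, hmem u huT hu⟩
  exact ⟨c, (congrArg Subtype.val hc).symm⟩

/-- The expansion of a normal vector in the null frame. -/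
theorem eq_of_orthogonal (h : IsHypercylinderTangent T x) {ξ u : Fin (n + 2) → ℝ}
    (hξ : IsNullNormal T x ξ) (huT : ∀ t ∈ T, minkForm (n + 1) t u = 0) :
    u = -(minkForm (n + 1) u ξ) • coneNormal n x -
      (minkForm (n + 1) u (coneNormal n x)) • ξ := by
  have hη := minkForm_coneNormal_self h.mem
  have hp := hξ.pairing
  obtain ⟨c, hc⟩ := h.exists_eq_smul_coneNormal
    (u := u + (minkForm (n + 1) u ξ) • coneNormal n x + (minkForm (n + 1) u (coneNormal n x)) • ξ)
    (fun t ht => by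
      simp only [map_add, map_smul, smul_eq_mul, huT t ht, hξ.orthogonal t ht, h.orthogonal t ht]
      ring)
    (by
      simp only [map_add, map_smul, LinearMap.add_apply, LinearMap.smul_apply, smul_eq_mul, hη, hp]
      ring)
  -- The vector just formed is orthogonal to ξ too, whereas ⟨cη, ξ⟩ = -c.
  have hc0 : c = 0 := by
    have := congrArg (fun v => minkForm (n + 1) v ξ) hc
    simp only [map_add, map_smul, LinearMap.add_apply, LinearMap.smul_apply, smul_eq_mul, hξ.null,
      minkForm_comm _ (coneNormal n x) ξ, hp] at this
    linarith
  rw [hc0, zero_smul] at hc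
  calc u = (u + (minkForm (n + 1) u ξ) • coneNormal n x +
      (minkForm (n + 1) u (coneNormal n x)) • ξ) - (minkForm (n + 1) u ξ) • coneNormal n x -
      (minkForm (n + 1) u (coneNormal n x)) • ξ := by abel
    _ = _ := by rw [hc]; simp

/-- Pair u with its expansion in the null frame. Applied to h(X, X), this factorization turns
isotropy into a condition on a product of two quadratic forms. -/
theorem minkForm_self_of_orthogonal (h : IsHypercylinderTangent T x) {ξ u : Fin (n + 2) → ℝ}
    (hξ : IsNullNormal T x ξ) (huT : ∀ t ∈ T, minkForm (n + 1) t u = 0) :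
    minkForm (n + 1) u u =
      -2 * (minkForm (n + 1) u ξ * minkForm (n + 1) u (coneNormal n x)) := by
  conv_lhs => arg 2; rw [h.eq_of_orthogonal hξ huT]
  simp only [map_sub, map_smul, smul_eq_mul]
  ring

/-- By the factorization ⟨ζ, ζ⟩ = 2⟨ζ, ξ⟩, so nullity kills the η-component of ζ. Uniqueness makes ξ
depend on T and x alone, hence not on a chart. -/
theorem isNullNormal_unique (h : IsHypercylinderTangent T x) {ξ ζ : Fin (n + 2) → ℝ}
    (hξ : IsNullNormal T x ξ) (hζ : IsNullNormal T x ζ) : ζ = ξ := by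
  have h1 := h.minkForm_self_of_orthogonal hξ hζ.orthogonal
  have h2 := h.eq_of_orthogonal hξ hζ.orthogonal
  rw [hζ.null, hζ.pairing] at h1
  have h3 : minkForm (n + 1) ζ ξ = 0 := by linarith
  rw [h3, hζ.pairing] at h2
  simpa using h2

/-- If `∂/∂x_{n+2}` is not tangent, then the last coordinate of the null normal is not zero. -/
theorem isNullNormal_last_ne_zero (h : IsHypercylinderTangent T x) {ξ : Fin (n + 2) → ℝ}
    (hξ : IsNullNormal T x ξ) (hT : lastDirection n ∉ T) : ξ (Fin.last (n + 1)) ≠ 0 := by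
  intro h0
  apply hT
  have hc := LinearMap.BilinForm.isCompl_orthogonal_of_restrict_nondegenerate
      (minkForm_isRefl (n + 1)) h.nondegenerate
  have hmem : lastDirection n ∈ T ⊔ (minkForm (n + 1)).orthogonal T := by
    rw [hc.sup_eq_top]; trivial
  obtain ⟨t, ht, u, hu, htu⟩ := Submodule.mem_sup.1 hmem
  rw [LinearMap.BilinForm.mem_orthogonal_iff] at hu
  have hu' : u = lastDirection n - t := by rw [← htu]; abel
  -- Both pairings of the normal part u of ∂/∂x_{n+2} are last coordinates, of ξ and of η; if both
  -- vanish then u = 0.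
  have h1 : minkForm (n + 1) u ξ = 0 := by
    rw [hu', map_sub, LinearMap.sub_apply, hξ.orthogonal t ht, minkForm_comm,
      minkForm_lastDirection, h0, sub_zero]
  have h2 : minkForm (n + 1) u (coneNormal n x) = 0 := by
    rw [hu', map_sub, LinearMap.sub_apply, h.orthogonal t ht, minkForm_comm,
      minkForm_lastDirection, coneNormal_last, sub_zero]
  have h3 := h.eq_of_orthogonal hξ hu
  rw [h1, h2] at h3
  simp only [neg_zero, zero_smul, sub_zero] at h3
  rw [← htu, h3, add_zero]
  exact ht

/-- The tangential part of `∂/∂x_{n+2}`. -/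
theorem exists_unit_last_eq_one (h : IsHypercylinderTangent T x) :
    ∃ t ∈ T, minkForm (n + 1) t t = 1 ∧ t (Fin.last (n + 1)) = 1 := by
  have hc := LinearMap.BilinForm.isCompl_orthogonal_of_restrict_nondegenerate
      (minkForm_isRefl (n + 1)) h.nondegenerate
  have hmem : lastDirection n ∈ T ⊔ (minkForm (n + 1)).orthogonal T := by
    rw [hc.sup_eq_top]; trivial
  obtain ⟨t, ht, u, hu, htu⟩ := Submodule.mem_sup.1 hmem
  rw [LinearMap.BilinForm.mem_orthogonal_iff] at hu
  have hu' : u = lastDirection n - t := by rw [← htu]; abel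
  have h2 : minkForm (n + 1) u (coneNormal n x) = 0 := by
    rw [hu', map_sub, LinearMap.sub_apply, h.orthogonal t ht, minkForm_comm,
      minkForm_lastDirection, coneNormal_last, sub_zero]
  -- The normal part of ∂/∂x_{n+2} is a multiple of η, whose last coordinate is 0, so the tangential
  -- part keeps last coordinate 1.
  obtain ⟨c, hc⟩ := h.exists_eq_smul_coneNormal hu h2
  have hl : t (Fin.last (n + 1)) = 1 := by
    have h3 := congrFun htu (Fin.last (n + 1))
    rw [Pi.add_apply, hc, Pi.smul_apply, coneNormal_last] at h3
    simpa [lastDirection] using h3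
  refine ⟨t, ht, ?_, hl⟩
  have h4 := minkForm_lastDirection n t
  rw [← htu, map_add, hu t ht, hl, add_zero] at h4
  exact h4

/-- The quadratic form `⟨t, t⟩ - (t_{n+2})²` is positive semidefinite on the tangent space. -/
theorem sq_last_le (h : IsHypercylinderTangent T x) {t : Fin (n + 2) → ℝ} (ht : t ∈ T) :
    0 ≤ minkForm (n + 1) t t - t (Fin.last (n + 1)) * t (Fin.last (n + 1)) := by
  have h1 := h.orthogonal t ht
  rw [minkForm_coneNormal] at h1
  have := minkForm_self_nonneg_of_orthogonal h.mem h1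
  rw [minkForm_eq_init_add_last]
  linarith

/-- Otherwise polarization makes the metric on T the rank-one form s_{n+2} t_{n+2}; nondegeneracy
then forces the last coordinate to be injective on T, so n ≤ 1. -/
theorem exists_sq_last_lt (h : IsHypercylinderTangent T x) (hn : 2 ≤ n) :
    ∃ t ∈ T, 0 < minkForm (n + 1) t t - t (Fin.last (n + 1)) * t (Fin.last (n + 1)) := by
  by_contra! hcon
  have hz : ∀ t ∈ T, minkForm (n + 1) t t = t (Fin.last (n + 1)) * t (Fin.last (n + 1)) :=
    fun t ht => by linarith [hcon t ht, h.sq_last_le ht]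
  have hpol : ∀ s ∈ T, ∀ t ∈ T,
      minkForm (n + 1) s t = s (Fin.last (n + 1)) * t (Fin.last (n + 1)) := by
    intro s hs t ht
    have h1 := hz _ (T.add_mem hs ht)
    simp only [map_add, LinearMap.add_apply, Pi.add_apply, hz s hs, hz t ht,
      minkForm_comm _ t s] at h1
    linarith
  let ℓ : T →ₗ[ℝ] ℝ := (LinearMap.proj (Fin.last (n + 1))).comp T.subtype
  have hℓ : Function.Injective ℓ := by
    rw [← LinearMap.ker_eq_bot, LinearMap.ker_eq_bot']
    intro t ht
    have ht' : (t : Fin (n + 2) → ℝ) (Fin.last (n + 1)) = 0 := ht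
    apply Subtype.ext
    exact h.eq_zero_of_mem t.2 fun s hs => by rw [hpol _ t.2 s hs, ht', zero_mul]
  have := LinearMap.finrank_le_finrank_of_injective hℓ
  rw [h.finrank_eq, Module.finrank_self] at this
  omega

end IsHypercylinderTangent

/-- If P(v, v) = 0, moving from v along u in a suitable direction makes P positive, so the affine
function t ↦ A(v, v) + 2t A(v, u) vanishes at two points and hence at t = 0. -/
theorem LinearMap.BilinForm.eq_zero_of_mul_eq_zero {E : Type*} [AddCommGroup E] [Module ℝ E]
    (A P : LinearMap.BilinForm ℝ E) (hA : ∀ v w, A v w = A w v) (hP : ∀ v, 0 ≤ P v v)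
    {u : E} (hu : 0 < P u u) (h : ∀ v, 0 < P v v → A v v = 0) (v w : E) : A v w = 0 := by
  have hdiag : ∀ v, A v v = 0 := by
    intro v
    rcases (hP v).lt_or_eq with hv | hv
    · exact h v hv
    have hPe : ∀ t : ℝ, P (v + t • u) (v + t • u) = t * (P v u + P u v) + t * t * P u u := by
      intro t
      simp only [map_add, map_smul, LinearMap.add_apply, LinearMap.smul_apply, smul_eq_mul, ← hv]
      ring
    have hAe : ∀ t : ℝ, A (v + t • u) (v + t • u) = A v v + 2 * t * A v u := by
      intro t
      simp only [map_add, map_smul, LinearMap.add_apply, LinearMap.smul_apply, smul_eq_mul, h u hu,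
        hA u v]
      ring
    -- The sign of t is chosen so that the linear term t (P v u + P u v) is nonnegative.
    rcases le_total 0 (P v u + P u v) with hs | hs
    · have h1 := h _ (by rw [hPe 1]; linarith)
      have h2 := h _ (by rw [hPe 2]; linarith)
      rw [hAe] at h1 h2
      linarith
    · have h1 := h _ (by rw [hPe (-1)]; linarith)
      have h2 := h _ (by rw [hPe (-2)]; linarith)
      rw [hAe] at h1 h2
      linarith
  have h1 := hdiag (v + w)
  simp only [map_add, LinearMap.add_apply, hdiag v, hdiag w, hA w v] at h1
  linarith

/-! ### The normal part and the algebraic consequence of isotropy. -/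

section NormalPart

variable {m : ℕ} {T : Submodule ℝ (Fin (m + 1) → ℝ)}

theorem minkForm_normalPart (hT : ((minkForm m).restrict T).Nondegenerate)
    (u : Fin (m + 1) → ℝ) {t : Fin (m + 1) → ℝ} (ht : t ∈ T) :
    minkForm m t (normalPart T hT u) = 0 := by
  have h : normalPart T hT u ∈ (minkForm m).orthogonal T := Submodule.projection_apply_mem _ u
  exact LinearMap.BilinForm.mem_orthogonal_iff.1 h t ht

theorem normalPart_minkForm (hT : ((minkForm m).restrict T).Nondegenerate)
    (u : Fin (m + 1) → ℝ) {ζ : Fin (m + 1) → ℝ} (hζ : ∀ t ∈ T, minkForm m t ζ = 0) :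
    minkForm m (normalPart T hT u) ζ = minkForm m u ζ := by
  have h : u - normalPart T hT u ∈ T := by
    rw [normalPart, Submodule.projection_eq_self_sub_projection
      (LinearMap.BilinForm.isCompl_orthogonal_of_restrict_nondegenerate (minkForm_isRefl m) hT),
      sub_sub_cancel]
    exact Submodule.projection_apply_mem _ u
  have := hζ _ h
  rw [map_sub, LinearMap.sub_apply] at this
  linarith

end NormalPart

namespace IsHypercylinderTangent

variable {n : ℕ} {T : Submodule ℝ (Fin (n + 2) → ℝ)} {x : Fin (n + 2) → ℝ}

theorem minkForm_normalPart_self (h : IsHypercylinderTangent T x) {ξ : Fin (n + 2) → ℝ}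
    (hξ : IsNullNormal T x ξ) (u : Fin (n + 2) → ℝ) :
    minkForm (n + 1) (normalPart T h.nondegenerate u) (normalPart T h.nondegenerate u) =
      -2 * (minkForm (n + 1) u ξ * minkForm (n + 1) u (coneNormal n x)) := by
  rw [h.minkForm_self_of_orthogonal hξ fun t ht => minkForm_normalPart h.nondegenerate u ht,
    normalPart_minkForm _ _ hξ.orthogonal, normalPart_minkForm _ _ h.orthogonal]

/-- The algebraic core: for an isotropic second fundamental form, the component of the second
derivative along the null normal `ξ` vanishes. -/
theorem minkForm_eq_zero_of_isotropic (hn : 2 ≤ n) {E : Type*} [AddCommGroup E] [Module ℝ E]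
    (D : E →ₗ[ℝ] (Fin (n + 2) → ℝ)) (S : E →ₗ[ℝ] E →ₗ[ℝ] (Fin (n + 2) → ℝ))
    (h : IsHypercylinderTangent (LinearMap.range D) x)
    (hS : ∀ v w, S v w = S w v)
    (hSη : ∀ v w, minkForm (n + 1) (S v w) (coneNormal n x) =
      -minkForm (n + 1) (D w) (coneNormal n (D v)))
    {ξ : Fin (n + 2) → ℝ} (hξ : IsNullNormal (LinearMap.range D) x ξ) {c : ℝ}
    (hiso : ∀ v, minkForm (n + 1) (D v) (D v) = 1 →
      minkForm (n + 1) (normalPart (LinearMap.range D) h.nondegenerate (S v v))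
        (normalPart (LinearMap.range D) h.nondegenerate (S v v)) = c) (v w : E) :
    minkForm (n + 1) (S v w) ξ = 0 := by
  have hiso' : ∀ v, minkForm (n + 1) (D v) (D v) = 1 →
      2 * (minkForm (n + 1) (S v v) ξ *
        (minkForm (n + 1) (D v) (D v) - D v (Fin.last (n + 1)) * D v (Fin.last (n + 1)))) = c := by
    intro v hv
    rw [← hiso v hv, h.minkForm_normalPart_self hξ, hSη, minkForm_coneNormal_eq_sub]
    ring
  -- Test on the tangential part of ∂/∂x_{n+2}, where the second factor is 1 - 1 = 0.
  have hc : c = 0 := by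
    obtain ⟨t, ⟨v, rfl⟩, h1, h2⟩ := h.exists_unit_last_eq_one
    rw [← hiso' v h1, h1, h2]
    ring
  let A : LinearMap.BilinForm ℝ E := S.compr₂ ((minkForm (n + 1)).flip ξ)
  let P : LinearMap.BilinForm ℝ E :=
    (minkForm (n + 1)).compl₁₂ D ((coneNormal n).toLinearMap.comp D)
  have hA : ∀ v w, A v w = minkForm (n + 1) (S v w) ξ := fun v w => rfl
  have hPe : ∀ v, P v v = minkForm (n + 1) (D v) (D v) -
      D v (Fin.last (n + 1)) * D v (Fin.last (n + 1)) := fun v => minkForm_coneNormal_eq_sub _ _ _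
  obtain ⟨t, ⟨u, rfl⟩, hu⟩ := h.exists_sq_last_lt hn
  rw [← hA]
  refine LinearMap.BilinForm.eq_zero_of_mul_eq_zero A P (fun v w => by rw [hA, hA, hS])
    (fun v => by rw [hPe]; exact h.sq_last_le ⟨v, rfl⟩) (u := u) (by rw [hPe]; exact hu) ?_ v w
  intro v hv
  -- P v v > 0 forces ⟨Dv, Dv⟩ > 0, so v can be rescaled to a unit vector.
  set q := minkForm (n + 1) (D v) (D v) with hq
  have hqpos : 0 < q := by
    rw [hPe] at hv
    nlinarith [mul_self_nonneg (D v (Fin.last (n + 1)))]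
  have hs : (√q)⁻¹ * (√q)⁻¹ * q = 1 := by
    rw [← mul_inv, Real.mul_self_sqrt hqpos.le, inv_mul_cancel₀ hqpos.ne']
  have h1 : minkForm (n + 1) (D ((√q)⁻¹ • v)) (D ((√q)⁻¹ • v)) = 1 := by
    simp only [map_smul, LinearMap.smul_apply, smul_eq_mul, ← hq]
    linarith
  have h2 := hiso' _ h1
  rw [hc, ← hPe] at h2
  have h3 : (√q)⁻¹ ≠ 0 := (inv_pos.2 (Real.sqrt_pos.2 hqpos)).ne'
  rw [← hA] at h2
  simp only [map_smul, LinearMap.smul_apply, smul_eq_mul] at h2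
  simpa [h3, hv.ne'] using h2

end IsHypercylinderTangent

/-! ### Differentiable dependence of the null normal on the tangent data. -/

section NullNormal

variable {n : ℕ}

/-- The Minkowski form as a continuous bilinear map. -/
noncomputable def minkCLM (m : ℕ) : (Fin (m + 1) → ℝ) →L[ℝ] (Fin (m + 1) → ℝ) →L[ℝ] ℝ :=
  (minkForm m).toContinuousBilinearMap

theorem minkCLM_apply (m : ℕ) (x y : Fin (m + 1) → ℝ) : minkCLM m x y = minkForm m x y := rfl

/-- The linear map `u ↦ (⟨u, D ·⟩, ⟨u, η⟩, u₀)`, whose invertibility provides the null normal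
vector. -/
noncomputable def nullFrame (D : EuclideanSpace ℝ (Fin n) →L[ℝ] (Fin (n + 2) → ℝ))
    (x : Fin (n + 2) → ℝ) :
    (Fin (n + 2) → ℝ) →L[ℝ] (EuclideanSpace ℝ (Fin n) →L[ℝ] ℝ) × ℝ × ℝ :=
  (ContinuousLinearMap.inl ℝ _ _).comp
    (((ContinuousLinearMap.compL ℝ _ _ ℝ).flip D).comp (minkCLM (n + 1))) +
  ((ContinuousLinearMap.inr ℝ _ _).comp (ContinuousLinearMap.inl ℝ ℝ ℝ)).comp
    ((minkCLM (n + 1)).flip (coneNormal n x)) +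
  ((ContinuousLinearMap.inr ℝ _ _).comp (ContinuousLinearMap.inr ℝ ℝ ℝ)).comp
    (ContinuousLinearMap.proj 0)

theorem nullFrame_apply (D : EuclideanSpace ℝ (Fin n) →L[ℝ] (Fin (n + 2) → ℝ))
    (x u : Fin (n + 2) → ℝ) :
    nullFrame D x u =
      ((minkCLM (n + 1) u).comp D, minkForm (n + 1) u (coneNormal n x), u 0) := by
  simp [nullFrame, minkCLM_apply]

/-- The first two components vanish only on multiples of η, and the time coordinate of η is
positive; the dimensions agree. -/
theorem exists_equiv_nullFrame {D : EuclideanSpace ℝ (Fin n) →L[ℝ] (Fin (n + 2) → ℝ)}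
    {x : Fin (n + 2) → ℝ} (h : IsHypercylinderTangent (LinearMap.range D.toLinearMap) x) :
    ∃ e : (Fin (n + 2) → ℝ) ≃L[ℝ] (EuclideanSpace ℝ (Fin n) →L[ℝ] ℝ) × ℝ × ℝ,
      (e : _ →L[ℝ] _) = nullFrame D x := by
  have hinj : Function.Injective (nullFrame D x).toLinearMap := by
    rw [← LinearMap.ker_eq_bot, LinearMap.ker_eq_bot']
    intro u hu
    have hu' : nullFrame D x u = 0 := hu
    rw [nullFrame_apply, Prod.mk_eq_zero, Prod.mk_eq_zero] at hu'
    obtain ⟨h1, h2, h3⟩ := hu'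
    obtain ⟨c, rfl⟩ := h.exists_eq_smul_coneNormal (u := u) (by
      rintro _ ⟨v, rfl⟩
      rw [minkForm_comm]
      exact congrArg (fun f => f v) h1) h2
    rw [Pi.smul_apply, coneNormal_zero, smul_eq_mul] at h3
    rcases mul_eq_zero.1 h3 with h4 | h4
    · rw [h4, zero_smul]
    · exact absurd h4 (ne_of_gt h.mem.2)
  have hdim : Module.finrank ℝ (Fin (n + 2) → ℝ) =
      Module.finrank ℝ ((EuclideanSpace ℝ (Fin n) →L[ℝ] ℝ) × ℝ × ℝ) := by
    have : Module.finrank ℝ (EuclideanSpace ℝ (Fin n) →L[ℝ] ℝ) = n := by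
      rw [← (LinearMap.toContinuousLinearMap (𝕜 := ℝ) (E := EuclideanSpace ℝ (Fin n))
        (F' := ℝ)).finrank_eq, Module.finrank_linearMap]
      simp
    simp [this]
  refine ⟨(LinearEquiv.ofInjectiveOfFinrankEq _ hinj hdim).toContinuousLinearEquiv, ?_⟩
  ext1 u
  rfl

/-- The null normal vector as a function of the differential and of the point. -/
noncomputable def nullNormal (D : EuclideanSpace ℝ (Fin n) →L[ℝ] (Fin (n + 2) → ℝ))
    (x : Fin (n + 2) → ℝ) : Fin (n + 2) → ℝ :=
  -- The inverse yields a normal u with ⟨u, η⟩ = -1 and u₀ = 0, the last condition only removing the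
  -- freedom along η. Adding (⟨u, u⟩ / 2) η makes it null.
  (nullFrame D x).inverse (0, -1, 0) +
    (minkCLM (n + 1) ((nullFrame D x).inverse (0, -1, 0))
      ((nullFrame D x).inverse (0, -1, 0)) / 2) • coneNormal n x

theorem isNullNormal_nullNormal {D : EuclideanSpace ℝ (Fin n) →L[ℝ] (Fin (n + 2) → ℝ)}
    {x : Fin (n + 2) → ℝ} (h : IsHypercylinderTangent (LinearMap.range D.toLinearMap) x) :
    IsNullNormal (LinearMap.range D.toLinearMap) x (nullNormal D x) := by
  obtain ⟨e, he⟩ := exists_equiv_nullFrame h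
  have hη := minkForm_coneNormal_self h.mem
  unfold nullNormal
  set u := (nullFrame D x).inverse (0, -1, 0) with hu
  have h1 : nullFrame D x u = (0, -1, 0) := by
    rw [hu, ← he, ContinuousLinearMap.inverse_equiv]
    simp
  rw [nullFrame_apply, Prod.mk.injEq, Prod.mk.injEq] at h1
  obtain ⟨h1, h2, -⟩ := h1
  refine ⟨fun t ht => ?_, ?_, ?_⟩
  · have h3 : minkForm (n + 1) t u = 0 := by
      obtain ⟨v, rfl⟩ := ht
      rw [minkForm_comm]
      exact congrArg (fun f => f v) h1
    rw [map_add, map_smul, h3, h.orthogonal t ht]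
    simp
  · simp only [map_add, map_smul, LinearMap.add_apply, LinearMap.smul_apply, smul_eq_mul, hη, h2,
      minkForm_comm _ (coneNormal n x) u, minkCLM_apply]
    ring
  · simp only [map_add, map_smul, LinearMap.add_apply, LinearMap.smul_apply, smul_eq_mul, hη, h2]
    ring

/-- Inversion of continuous linear maps is smooth at an invertible one, and the frame map depends
differentiably on D and g. -/
theorem differentiableAt_nullNormal {E : Type*} [NormedAddCommGroup E] [NormedSpace ℝ E]
    {D : E → EuclideanSpace ℝ (Fin n) →L[ℝ] (Fin (n + 2) → ℝ)} {g : E → Fin (n + 2) → ℝ} {a : E}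
    (hD : DifferentiableAt ℝ D a) (hg : DifferentiableAt ℝ g a)
    (h : IsHypercylinderTangent (LinearMap.range (D a).toLinearMap) (g a)) :
    DifferentiableAt ℝ (fun y => nullNormal (D y) (g y)) a := by
  obtain ⟨e, he⟩ := exists_equiv_nullFrame h
  have hF : DifferentiableAt ℝ (fun y => nullFrame (D y) (g y)) a := by
    have h1 : DifferentiableAt ℝ (fun y => ((ContinuousLinearMap.compL ℝ (EuclideanSpace ℝ (Fin n))
        (Fin (n + 2) → ℝ) ℝ).flip (D y)).comp (minkCLM (n + 1))) a :=
      (((ContinuousLinearMap.compL ℝ (EuclideanSpace ℝ (Fin n))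
        (Fin (n + 2) → ℝ) ℝ).flip.differentiableAt).comp a hD).clm_comp (differentiableAt_const _)
    have h2 : DifferentiableAt ℝ (fun y => (minkCLM (n + 1)).flip (coneNormal n (g y))) a :=
      (minkCLM (n + 1)).flip.differentiableAt.comp a ((coneNormal n).differentiableAt.comp a hg)
    have h3 := (differentiableAt_const (𝕜 := ℝ) (x := a)
      (ContinuousLinearMap.inl ℝ (EuclideanSpace ℝ (Fin n) →L[ℝ] ℝ) (ℝ × ℝ))).clm_comp h1
    have h4 := (differentiableAt_const (𝕜 := ℝ) (x := a)
      ((ContinuousLinearMap.inr ℝ (EuclideanSpace ℝ (Fin n) →L[ℝ] ℝ) (ℝ × ℝ)).comp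
        (ContinuousLinearMap.inl ℝ ℝ ℝ))).clm_comp h2
    exact (h3.fun_add h4).add_const _
  have hinv : DifferentiableAt ℝ (fun y => (nullFrame (D y) (g y)).inverse) a := by
    have h1 := (contDiffAt_map_inverse (𝕜 := ℝ) (n := 1) e).differentiableAt one_ne_zero
    rw [he] at h1
    exact DifferentiableAt.comp
      (F := (Fin (n + 2) → ℝ) →L[ℝ] (EuclideanSpace ℝ (Fin n) →L[ℝ] ℝ) × ℝ × ℝ)
      (f := fun y => nullFrame (D y) (g y)) a h1 hF
  have hu : DifferentiableAt ℝ (fun y => (nullFrame (D y) (g y)).inverse (0, -1, 0)) a :=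
    hinv.clm_apply (differentiableAt_const _)
  have hη : DifferentiableAt ℝ (fun y => coneNormal n (g y)) a :=
    (coneNormal n).differentiableAt.comp a hg
  have hq : DifferentiableAt ℝ (fun y => (2 : ℝ)⁻¹ * minkCLM (n + 1)
      ((nullFrame (D y) (g y)).inverse (0, -1, 0))
      ((nullFrame (D y) (g y)).inverse (0, -1, 0))) a :=
    (((minkCLM (n + 1)).differentiableAt.comp a hu).clm_apply hu).const_mul _
  have hfin := hu.fun_add (hq.fun_smul hη)
  simp only [inv_mul_eq_div] at hfin
  exact hfin

end NullNormal

/-! ### Calculus in a chart -/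

open Filter Topology

section Calculus

variable {E : Type*} [NormedAddCommGroup E] [NormedSpace ℝ E] {m : ℕ}

theorem HasFDerivAt.minkForm_apply {f g : E → Fin (m + 1) → ℝ} {f' g' : E →L[ℝ] (Fin (m + 1) → ℝ)} {a : E}
    (hf : HasFDerivAt f f' a) (hg : HasFDerivAt g g' a) {D : E →L[ℝ] ℝ}
    (h : HasFDerivAt (fun x => minkForm m (f x) (g x)) D a) (v : E) :
    D v = minkForm m (f a) (g' v) + minkForm m (f' v) (g a) := by
  have h2 := (minkCLM m).hasFDerivAt_of_bilinear hf hg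
  rw [h.unique h2]
  simp [minkCLM_apply]

theorem minkForm_fderiv_eq_zero_of_const {f g : E → Fin (m + 1) → ℝ}
    {f' g' : E →L[ℝ] (Fin (m + 1) → ℝ)} {a : E} (hf : HasFDerivAt f f' a) (hg : HasFDerivAt g g' a)
    {c : ℝ} (h : ∀ᶠ x in 𝓝 a, minkForm m (f x) (g x) = c) (v : E) :
    minkForm m (f a) (g' v) + minkForm m (f' v) (g a) = 0 := by
  have h1 : HasFDerivAt (fun x => minkForm m (f x) (g x)) (0 : E →L[ℝ] ℝ) a :=
    (hasFDerivAt_const c a).congr_of_eventuallyEq h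
  simpa using (hf.minkForm_apply hg h1 v).symm

/-- Differentiating the relation `⟨ν, dg(w)⟩ = 0`. -/
theorem minkForm_second_fderiv {g ν : E → Fin (m + 1) → ℝ} {ν' : E →L[ℝ] (Fin (m + 1) → ℝ)} {a : E}
    (hg : ContDiffAt ℝ 2 g a) (hν : HasFDerivAt ν ν' a) {w : E}
    (h : ∀ᶠ x in 𝓝 a, minkForm m (fderiv ℝ g x w) (ν x) = 0) (v : E) :
    minkForm m (fderiv ℝ (fderiv ℝ g) a v w) (ν a) = -minkForm m (fderiv ℝ g a w) (ν' v) := by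
  have hd : HasFDerivAt (fderiv ℝ g) (fderiv ℝ (fderiv ℝ g) a) a :=
    ((hg.fderiv_right (m := 1) (by norm_num)).differentiableAt one_ne_zero).hasFDerivAt
  have hdw : HasFDerivAt (fun x => fderiv ℝ g x w) ((fderiv ℝ (fderiv ℝ g) a).flip w) a := by
    simpa using hd.clm_apply (hasFDerivAt_const w a)
  have := minkForm_fderiv_eq_zero_of_const hdw hν h v
  rw [ContinuousLinearMap.flip_apply] at this
  linarith

theorem fderiv_fderiv_apply {F : Type*} [NormedAddCommGroup F] [NormedSpace ℝ F] {g : E → F} {a : E}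
    (hg : ContDiffAt ℝ 2 g a) (v w : E) :
    fderiv ℝ (fun x => fderiv ℝ g x w) a v = fderiv ℝ (fderiv ℝ g) a v w := by
  have hd : HasFDerivAt (fderiv ℝ g) (fderiv ℝ (fderiv ℝ g) a) a :=
    ((hg.fderiv_right (m := 1) (by norm_num)).differentiableAt one_ne_zero).hasFDerivAt
  have hdw : HasFDerivAt (fun x => fderiv ℝ g x w) ((fderiv ℝ (fderiv ℝ g) a).flip w) a := by
    simpa using hd.clm_apply (hasFDerivAt_const w a)
  rw [hdw.fderiv]
  rfl

end Calculus

section Chart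

variable {n : ℕ} {M : Type*} [TopologicalSpace M] [ChartedSpace (EuclideanSpace ℝ (Fin n)) M]

/-- The local parametrization of a submanifold inverse to the chart at `p`. -/
noncomputable def chartRepr {V : Type*} (φ : M → V) (p : M) : EuclideanSpace ℝ (Fin n) → V :=
  φ ∘ (extChartAt (𝓡 n) p).symm

theorem chartRepr_self {V : Type*} (φ : M → V) (p : M) :
    chartRepr φ p (extChartAt (𝓡 n) p p) = φ p := by
  simp [chartRepr]

theorem eventually_extChartAt_symm {P : M → Prop} {p : M} (h : ∀ᶠ q in 𝓝 p, P q) :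
    ∀ᶠ x in 𝓝 (extChartAt (𝓡 n) p p), P ((extChartAt (𝓡 n) p).symm x) := by
  have hc := continuousAt_extChartAt_symm (I := 𝓡 n) p
  rw [ContinuousAt, extChartAt_to_inv] at hc
  exact hc.eventually h

theorem differential_eq_fderiv_chartRepr {m : ℕ} {φ : M → Fin (m + 1) → ℝ}
    (hφ : ContMDiff (𝓡 n) 𝓘(ℝ, Fin (m + 1) → ℝ) ∞ φ) (p : M) :
    differential n φ p = fderiv ℝ (chartRepr φ p) (extChartAt (𝓡 n) p p) := by
  have h : HasFDerivWithinAt (chartRepr φ p) (differential n φ p) (Set.range (𝓡 n))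
      (extChartAt (𝓡 n) p p) := ((hφ p).mdifferentiableAt (by simp)).hasMFDerivAt.2
  rw [ModelWithCorners.range_eq_univ, hasFDerivWithinAt_univ] at h
  exact h.fderiv.symm

variable [IsManifold (𝓡 n) ∞ M]

theorem contDiffAt_chartRepr {V : Type*} [NormedAddCommGroup V] [NormedSpace ℝ V] {φ : M → V}
    (hφ : ContMDiff (𝓡 n) 𝓘(ℝ, V) ∞ φ) (p : M) {x : EuclideanSpace ℝ (Fin n)}
    (hx : x ∈ (extChartAt (𝓡 n) p).target) : ContDiffAt ℝ ∞ (chartRepr φ p) x := by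
  have h1 := (contMDiffOn_extChartAt_symm (n := ∞) (I := 𝓡 n) p).contMDiffAt
    ((isOpen_extChartAt_target (I := 𝓡 n) p).mem_nhds hx)
  exact (hφ.contMDiffAt.comp x h1).contDiffAt

/-- Away from the centre of the chart at p, the derivative differs from the differential in the
point's own chart by a linear isomorphism of the source. Range and injectivity are therefore
unaffected. -/
theorem fderiv_chartRepr {m : ℕ} {φ : M → Fin (m + 1) → ℝ}
    (hφ : ContMDiff (𝓡 n) 𝓘(ℝ, Fin (m + 1) → ℝ) ∞ φ) (p : M) {x : EuclideanSpace ℝ (Fin n)}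
    (hx : x ∈ (extChartAt (𝓡 n) p).target) :
    ∃ e : EuclideanSpace ℝ (Fin n) ≃L[ℝ] EuclideanSpace ℝ (Fin n),
      fderiv ℝ (chartRepr φ p) x =
        (differential n φ ((extChartAt (𝓡 n) p).symm x)).comp e.toContinuousLinearMap := by
  have h1 := (contMDiffOn_extChartAt_symm (n := ∞) (I := 𝓡 n) p).contMDiffAt
    ((isOpen_extChartAt_target (I := 𝓡 n) p).mem_nhds hx)
  have h2 := isInvertible_mfderivWithin_extChartAt_symm (I := 𝓡 n) hx
  rw [ModelWithCorners.range_eq_univ, mfderivWithin_univ] at h2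
  obtain ⟨e, he⟩ := h2
  refine ⟨e, ?_⟩
  have h3 := mfderiv_comp x (hφ.contMDiffAt.mdifferentiableAt (by simp))
    (h1.mdifferentiableAt (by simp))
  rw [← he, mfderiv_eq_fderiv] at h3
  exact h3

theorem range_fderiv_chartRepr {m : ℕ} {φ : M → Fin (m + 1) → ℝ}
    (hφ : ContMDiff (𝓡 n) 𝓘(ℝ, Fin (m + 1) → ℝ) ∞ φ) (p : M) {x : EuclideanSpace ℝ (Fin n)}
    (hx : x ∈ (extChartAt (𝓡 n) p).target) :
    LinearMap.range (fderiv ℝ (chartRepr φ p) x).toLinearMap =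
      imageTangent n φ ((extChartAt (𝓡 n) p).symm x) := by
  obtain ⟨e, he⟩ := fderiv_chartRepr hφ p hx
  rw [he, imageTangent]
  exact LinearMap.range_comp_of_range_eq_top _ (LinearMap.range_eq_top.2 e.surjective)

/-- Chain rule for the change of charts. Derivatives are computed only at the centre of each point's
own chart; this transports their vanishing to one fixed chart. -/
theorem HasFDerivAt.chartRepr_zero {V : Type*} [NormedAddCommGroup V] [NormedSpace ℝ V] {N : M → V}
    (p : M) {x : EuclideanSpace ℝ (Fin n)} (hx : x ∈ (extChartAt (𝓡 n) p).target)
    (h : HasFDerivAt (chartRepr N ((extChartAt (𝓡 n) p).symm x))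
      (0 : EuclideanSpace ℝ (Fin n) →L[ℝ] V)
      (extChartAt (𝓡 n) ((extChartAt (𝓡 n) p).symm x) ((extChartAt (𝓡 n) p).symm x))) :
    HasFDerivAt (chartRepr N p) (0 : EuclideanSpace ℝ (Fin n) →L[ℝ] V) x := by
  set q := (extChartAt (𝓡 n) p).symm x with hq
  have h1 := (contMDiffOn_extChartAt_symm (n := ∞) (I := 𝓡 n) p).contMDiffAt
    ((isOpen_extChartAt_target (I := 𝓡 n) p).mem_nhds hx)
  have h2 : ContMDiffAt (𝓡 n) 𝓘(ℝ, EuclideanSpace ℝ (Fin n)) ∞ (extChartAt (𝓡 n) q) q :=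
    contMDiffAt_extChartAt
  have h3 : ContDiffAt ℝ ∞ (extChartAt (𝓡 n) q ∘ (extChartAt (𝓡 n) p).symm) x :=
    (h2.comp x h1).contDiffAt
  have h4 := (h3.differentiableAt (by simp)).hasFDerivAt
  have h5 := HasFDerivAt.comp (g := chartRepr N q) x h h4
  rw [ContinuousLinearMap.zero_comp] at h5
  refine h5.congr_of_eventuallyEq ?_
  have h6 : ∀ᶠ y in 𝓝 x, (extChartAt (𝓡 n) p).symm y ∈ (extChartAt (𝓡 n) q).source :=
    h1.continuousAt.eventually (extChartAt_source_mem_nhds (I := 𝓡 n) q)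
  filter_upwards [h6] with y hy
  simp only [chartRepr, Function.comp_apply]
  rw [(extChartAt (𝓡 n) q).left_inv hy]

end Chart

/-! ### Tangent spaces and second derivatives of a submanifold of the hypercylinder. -/

section Submanifold

variable {n : ℕ} {M : Type*} [TopologicalSpace M] [ChartedSpace (EuclideanSpace ℝ (Fin n)) M]
  [IsManifold (𝓡 n) ∞ M] {φ : M → Fin (n + 2) → ℝ}

/-- Normality of η comes from differentiating ⟨η, η⟩ = 0 along M. -/
theorem IsNondegenerateImmersion.isHypercylinderTangent (hφ : IsNondegenerateImmersion n φ)
    (hLC : ∀ p, φ p ∈ lightHypercylinder n) (p : M) :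
    IsHypercylinderTangent (imageTangent n φ p) (φ p) := by
  refine ⟨?_, hφ.nondegenerate p, hLC p, ?_⟩
  · rw [imageTangent, LinearMap.finrank_range_of_inj (hφ.injective p)]
    simp
  · rintro _ ⟨v, rfl⟩
    have hg := (contDiffAt_chartRepr hφ.smooth p (mem_extChartAt_target (I := 𝓡 n) p))
    have h1 := (hg.differentiableAt (by simp)).hasFDerivAt
    have h2 := (coneNormal n).hasFDerivAt.comp _ h1
    have h3 := minkForm_fderiv_eq_zero_of_const h2 h2 (c := 0) (Eventually.of_forall fun x =>
      minkForm_coneNormal_self (hLC ((extChartAt (𝓡 n) p).symm x))) v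
    rw [ContinuousLinearMap.coe_coe, differential_eq_fderiv_chartRepr hφ.smooth]
    simp only [Function.comp_apply, ContinuousLinearMap.comp_apply, chartRepr_self,
      minkForm_coneNormal, init_coneNormal] at h3
    rw [minkForm_comm n (Fin.init (φ p))] at h3
    rw [minkForm_coneNormal]
    linarith

theorem secondFundamentalForm_eq (hφ : IsNondegenerateImmersion n φ) (p : M)
    (v w : EuclideanSpace ℝ (Fin n)) :
    secondFundamentalForm hφ p v w = normalPart (imageTangent n φ p) (hφ.nondegenerate p)
      (fderiv ℝ (fderiv ℝ (chartRepr φ p)) (extChartAt (𝓡 n) p p) v w) := by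
  have hg := (contDiffAt_chartRepr hφ.smooth p (mem_extChartAt_target (I := 𝓡 n) p)).of_le
    (m := 2) (WithTop.coe_le_coe.2 le_top)
  rw [← fderiv_fderiv_apply hg]
  rfl

/-- A null normal field which is differentiable at `p` in the chart: the second derivative along it. -/
theorem minkForm_secondDeriv_of_orthogonal (hφ : IsNondegenerateImmersion n φ)
    {ν : M → Fin (n + 2) → ℝ} {p : M} {ν' : EuclideanSpace ℝ (Fin n) →L[ℝ] (Fin (n + 2) → ℝ)}
    (hν : HasFDerivAt (chartRepr ν p) ν' (extChartAt (𝓡 n) p p))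
    (h : ∀ᶠ q in 𝓝 p, ∀ t ∈ imageTangent n φ q, minkForm (n + 1) t (ν q) = 0)
    (v w : EuclideanSpace ℝ (Fin n)) :
    minkForm (n + 1) (fderiv ℝ (fderiv ℝ (chartRepr φ p)) (extChartAt (𝓡 n) p p) v w) (ν p) =
      -minkForm (n + 1) (differential n φ p w) (ν' v) := by
  have hg := (contDiffAt_chartRepr hφ.smooth p (mem_extChartAt_target (I := 𝓡 n) p)).of_le
    (m := 2) (WithTop.coe_le_coe.2 le_top)
  have h1 := minkForm_second_fderiv hg hν (w := w) (by
    have h2 := eventually_extChartAt_symm (n := n) h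
    filter_upwards [h2, (isOpen_extChartAt_target (I := 𝓡 n) p).mem_nhds
      (mem_extChartAt_target (I := 𝓡 n) p)] with x hx hxt
    refine hx _ ?_
    have h3 := range_fderiv_chartRepr hφ.smooth p hxt
    rw [← h3]
    exact ⟨w, rfl⟩) v
  rw [chartRepr_self] at h1
  rw [h1, differential_eq_fderiv_chartRepr hφ.smooth]

theorem minkForm_secondDeriv_coneNormal (hφ : IsNondegenerateImmersion n φ)
    (hLC : ∀ p, φ p ∈ lightHypercylinder n) (p : M) (v w : EuclideanSpace ℝ (Fin n)) :
    minkForm (n + 1) (fderiv ℝ (fderiv ℝ (chartRepr φ p)) (extChartAt (𝓡 n) p p) v w)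
      (coneNormal n (φ p)) =
      -minkForm (n + 1) (differential n φ p w) (coneNormal n (differential n φ p v)) := by
  have hg := (contDiffAt_chartRepr hφ.smooth p (mem_extChartAt_target (I := 𝓡 n) p))
  have h1 := (hg.differentiableAt (by simp)).hasFDerivAt
  have h2 := (coneNormal n).hasFDerivAt.comp _ h1
  have h3 := minkForm_secondDeriv_of_orthogonal hφ (ν := fun q => coneNormal n (φ q)) (p := p) h2
    (Eventually.of_forall fun q t ht => (hφ.isHypercylinderTangent hLC q).orthogonal t ht) v w
  rw [h3, differential_eq_fderiv_chartRepr hφ.smooth]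
  rfl

/-- A constant null vector normal to the submanifold near `p` makes the second fundamental form
null. -/
theorem minkForm_secondFundamentalForm_eq_zero (hφ : IsNondegenerateImmersion n φ)
    (hLC : ∀ p, φ p ∈ lightHypercylinder n) {p : M} {N : Fin (n + 2) → ℝ} {c : ℝ}
    (hN : minkForm (n + 1) N N = 0) (hNη : minkForm (n + 1) N (coneNormal n (φ p)) ≠ 0)
    (h : ∀ᶠ q in 𝓝 p, minkForm (n + 1) (φ q) N = c) (v w : TangentSpace (𝓡 n) p) :
    minkForm (n + 1) (secondFundamentalForm hφ p v w) (secondFundamentalForm hφ p v w) = 0 := by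
  have hT := hφ.isHypercylinderTangent hLC
  have horth : ∀ᶠ q in 𝓝 p, ∀ t ∈ imageTangent n φ q, minkForm (n + 1) t N = 0 := by
    filter_upwards [eventually_eventually_nhds.2 h] with q hq
    rintro _ ⟨u, rfl⟩
    have hg := (contDiffAt_chartRepr hφ.smooth q (mem_extChartAt_target (I := 𝓡 n) q))
    have h1 := (hg.differentiableAt (by simp)).hasFDerivAt
    have h2 := minkForm_fderiv_eq_zero_of_const h1 (hasFDerivAt_const N _)
      (eventually_extChartAt_symm hq) u
    rw [ContinuousLinearMap.coe_coe, differential_eq_fderiv_chartRepr hφ.smooth]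
    simpa using h2
  -- N is normal because ⟨φ, N⟩ is locally constant, so a rescaling of N is ξ. As N has zero
  -- derivative, the ξ-factor of ⟨h, h⟩ vanishes.
  have hξ : IsNullNormal (imageTangent n φ p) (φ p)
      (-(minkForm (n + 1) N (coneNormal n (φ p)))⁻¹ • N) := by
    refine ⟨fun t ht => ?_, ?_, ?_⟩
    · rw [map_smul, horth.self_of_nhds t ht, smul_zero]
    · simp [hN]
    · simp [hNη]
  have h1 := minkForm_secondDeriv_of_orthogonal hφ (ν := fun _ => N) (p := p)
    (hasFDerivAt_const N _) horth v w
  have h2 := secondFundamentalForm_eq hφ p v w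
  refine (congrArg (fun u => minkForm (n + 1) u u) h2).trans ?_
  refine ((hT p).minkForm_normalPart_self hξ _).trans ?_
  have h3 : (0 : EuclideanSpace ℝ (Fin n) →L[ℝ] (Fin (n + 2) → ℝ)) v = 0 := rfl
  rw [map_smul, h1, h3]
  simp

end Submanifold

/-! ### Isotropy makes the normalized null normal locally constant. -/

section NullNormalField

variable {n : ℕ} {M : Type*} [TopologicalSpace M] [ChartedSpace (EuclideanSpace ℝ (Fin n)) M]

/-- The null normal vector field of a submanifold of the light-like hypercylinder. -/
noncomputable def nullNormalField (φ : M → Fin (n + 2) → ℝ) (q : M) : Fin (n + 2) → ℝ :=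
  nullNormal (differential n φ q) (φ q)

/-- The multiple of the null normal vector field with last coordinate `1`. -/
noncomputable def normalizedNullNormalField (φ : M → Fin (n + 2) → ℝ) (q : M) : Fin (n + 2) → ℝ :=
  (nullNormalField φ q (Fin.last (n + 1)))⁻¹ • nullNormalField φ q

variable {φ : M → Fin (n + 2) → ℝ} [IsManifold (𝓡 n) ∞ M]

theorem isNullNormal_nullNormalField (hφ : IsNondegenerateImmersion n φ)
    (hLC : ∀ p, φ p ∈ lightHypercylinder n) (q : M) :
    IsNullNormal (imageTangent n φ q) (φ q) (nullNormalField φ q) :=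
  isNullNormal_nullNormal (hφ.isHypercylinderTangent hLC q)

/-- The field is defined by differentials in charts varying with the point. By uniqueness of the
null normal it agrees with the one built from the derivative in the fixed chart at p. -/
theorem differentiableAt_nullNormalField (hφ : IsNondegenerateImmersion n φ)
    (hLC : ∀ p, φ p ∈ lightHypercylinder n) (p : M) :
    DifferentiableAt ℝ (chartRepr (n := n) (nullNormalField φ) p) (extChartAt (𝓡 n) p p) := by
  have hg := contDiffAt_chartRepr hφ.smooth p (mem_extChartAt_target (I := 𝓡 n) p)
  have hT : ∀ x ∈ (extChartAt (𝓡 n) p).target, IsHypercylinderTangent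
      (LinearMap.range (fderiv ℝ (chartRepr φ p) x).toLinearMap) (chartRepr φ p x) := by
    intro x hx
    rw [range_fderiv_chartRepr hφ.smooth p hx]
    exact hφ.isHypercylinderTangent hLC _
  have h1 : DifferentiableAt ℝ (fun x => nullNormal (fderiv ℝ (chartRepr φ p) x) (chartRepr φ p x))
      (extChartAt (𝓡 n) p p) :=
    differentiableAt_nullNormal
      (((hg.of_le (m := 2) (WithTop.coe_le_coe.2 le_top)).fderiv_right (m := 1)
        (by norm_num)).differentiableAt one_ne_zero)
      (hg.differentiableAt (by simp)) (hT _ (mem_extChartAt_target (I := 𝓡 n) p))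
  refine h1.congr_of_eventuallyEq ?_
  filter_upwards [(isOpen_extChartAt_target (I := 𝓡 n) p).mem_nhds
      (mem_extChartAt_target (I := 𝓡 n) p)] with x hx
  refine (hT x hx).isNullNormal_unique (isNullNormal_nullNormal (hT x hx)) ?_
  rw [range_fderiv_chartRepr hφ.smooth p hx]
  exact isNullNormal_nullNormalField hφ hLC _

theorem minkForm_secondDeriv_nullNormalField (hn : 2 ≤ n) (hφ : IsNondegenerateImmersion n φ)
    (hLC : ∀ p, φ p ∈ lightHypercylinder n) {lam : M → ℝ} (hiso : IsIsotropicImmersion hφ lam)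
    (p : M) (v w : EuclideanSpace ℝ (Fin n)) :
    minkForm (n + 1) (fderiv ℝ (fderiv ℝ (chartRepr φ p)) (extChartAt (𝓡 n) p p) v w)
      (nullNormalField φ p) = 0 := by
  have hg := contDiffAt_chartRepr hφ.smooth p (mem_extChartAt_target (I := 𝓡 n) p)
  have hsymm := hg.isSymmSndFDerivAt
    (by rw [minSmoothness_of_isRCLikeNormedField]; exact WithTop.coe_le_coe.2 le_top)
  let S := (fderiv ℝ (fderiv ℝ (chartRepr φ p)) (extChartAt (𝓡 n) p p)).toLinearMap₁₂
  refine (hφ.isHypercylinderTangent hLC p).minkForm_eq_zero_of_isotropic hn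
    (differential n φ p).toLinearMap S (fun v w => hsymm v w)
    (fun v w => minkForm_secondDeriv_coneNormal hφ hLC p v w)
    (isNullNormal_nullNormalField hφ hLC p) (c := lam p) ?_ v w
  intro v hv
  have h1 := hiso.2 p v hv
  have h2 := secondFundamentalForm_eq hφ p v v
  exact (congrArg (fun u => minkForm (n + 1) u u) h2).symm.trans h1

/-- The derivative of ξ is normal since ⟨S, ξ⟩ = 0, and orthogonal to ξ since ξ is null, so it is τξ
for a covector τ; dividing by the last coordinate cancels τ. -/
theorem hasFDerivAt_normalizedNullNormalField (hn : 2 ≤ n) (hφ : IsNondegenerateImmersion n φ)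
    (hLC : ∀ p, φ p ∈ lightHypercylinder n) (hα : ∀ p, lastDirection n ∉ imageTangent n φ p)
    {lam : M → ℝ} (hiso : IsIsotropicImmersion hφ lam) (p : M) :
    HasFDerivAt (chartRepr (normalizedNullNormalField φ) p)
      (0 : EuclideanSpace ℝ (Fin n) →L[ℝ] (Fin (n + 2) → ℝ)) (extChartAt (𝓡 n) p p) := by
  have hT := hφ.isHypercylinderTangent hLC
  have hξ := isNullNormal_nullNormalField hφ hLC
  have hν := (differentiableAt_nullNormalField hφ hLC p).hasFDerivAt
  set ν' := fderiv ℝ (chartRepr (n := n) (nullNormalField φ) p) (extChartAt (𝓡 n) p p) with hν'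
  have horth : ∀ v, ∀ t ∈ imageTangent n φ p, minkForm (n + 1) t (ν' v) = 0 := by
    rintro v _ ⟨w, rfl⟩
    have h1 := minkForm_secondDeriv_of_orthogonal hφ hν
      (Eventually.of_forall fun q => (hξ q).orthogonal) v w
    rw [minkForm_secondDeriv_nullNormalField hn hφ hLC hiso] at h1
    exact neg_eq_zero.1 h1.symm
  have hnull : ∀ v, minkForm (n + 1) (ν' v) (nullNormalField φ p) = 0 := by
    intro v
    have h1 := minkForm_fderiv_eq_zero_of_const hν hν (c := 0)
      (Eventually.of_forall fun x => (hξ _).null) v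
    rw [chartRepr_self, minkForm_comm] at h1
    linarith
  have hτ : ∀ v, ν' v = -(minkForm (n + 1) (ν' v) (coneNormal n (φ p))) • nullNormalField φ p := by
    intro v
    have h1 := (hT p).eq_of_orthogonal (hξ p) (horth v)
    rw [hnull v] at h1
    simpa using h1
  have hl := (hT p).isNullNormal_last_ne_zero (hξ p) (hα p)
  have hlast : HasFDerivAt
      (fun x => chartRepr (n := n) (nullNormalField φ) p x (Fin.last (n + 1)))
      ((ContinuousLinearMap.proj (R := ℝ) (φ := fun _ : Fin (n + 2) => ℝ)
        (Fin.last (n + 1))).comp ν') (extChartAt (𝓡 n) p p) :=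
    (ContinuousLinearMap.proj (R := ℝ) (φ := fun _ : Fin (n + 2) => ℝ)
        (Fin.last (n + 1))).hasFDerivAt.comp _ hν
  have hinv := HasFDerivAt.comp (g := fun y : ℝ => y⁻¹) _
    (hasFDerivAt_inv (by rw [chartRepr_self]; exact hl)) hlast
  have hmain := HasFDerivAt.fun_smul hinv hν
  refine hmain.congr_fderiv ?_
  ext1 v
  simp only [_root_.add_apply, _root_.smul_apply,
    ContinuousLinearMap.smulRight_apply, ContinuousLinearMap.comp_apply,
    ContinuousLinearMap.proj_apply, Function.comp_apply, _root_.zero_apply,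
    chartRepr_self]
  rw [hτ v]
  simp only [Pi.smul_apply, smul_eq_mul, smul_smul, ← add_smul]
  convert zero_smul ℝ (nullNormalField φ p) using 2
  simp
  field_simp
  ring

/-- An isotropic submanifold has locally a constant null normal vector. -/
theorem exists_const_null_normal (hn : 2 ≤ n) (hφ : IsNondegenerateImmersion n φ)
    (hLC : ∀ p, φ p ∈ lightHypercylinder n) (hα : ∀ p, lastDirection n ∉ imageTangent n φ p)
    {lam : M → ℝ} (hiso : IsIsotropicImmersion hφ lam) (p : M) :
    ∃ N : Fin (n + 2) → ℝ, N (Fin.last (n + 1)) = 1 ∧ minkForm (n + 1) N N = 0 ∧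
      ∀ᶠ q in 𝓝 p, minkForm (n + 1) (φ q) N = minkForm (n + 1) (φ p) N ∧
        minkForm (n + 1) N (coneNormal n (φ q)) ≠ 0 := by
  have hT := hφ.isHypercylinderTangent hLC
  have hξ := isNullNormal_nullNormalField hφ hLC
  have hl := fun q => (hT q).isNullNormal_last_ne_zero (hξ q) (hα q)
  -- On a ball in the chart, which is connected, vanishing derivative implies constancy.
  obtain ⟨r, hr, hball⟩ := Metric.isOpen_iff.1 (isOpen_extChartAt_target (I := 𝓡 n) p) _
    (mem_extChartAt_target (I := 𝓡 n) p)
  have hcenter : extChartAt (𝓡 n) p p ∈ Metric.ball (extChartAt (𝓡 n) p p) r :=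
    Metric.mem_ball_self hr
  have hpre : IsPreconnected (Metric.ball (extChartAt (𝓡 n) p p) r) :=
    (convex_ball _ _).isPreconnected
  have hN : ∀ x ∈ Metric.ball (extChartAt (𝓡 n) p p) r,
      HasFDerivAt (chartRepr (normalizedNullNormalField φ) p)
      (0 : EuclideanSpace ℝ (Fin n) →L[ℝ] (Fin (n + 2) → ℝ)) x := fun x hx =>
    HasFDerivAt.chartRepr_zero p (hball hx)
      (hasFDerivAt_normalizedNullNormalField hn hφ hLC hα hiso _)
  have hconst : ∀ x ∈ Metric.ball (extChartAt (𝓡 n) p p) r,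
      chartRepr (n := n) (normalizedNullNormalField φ) p x = normalizedNullNormalField φ p := by
    intro x hx
    rw [← chartRepr_self (n := n) (normalizedNullNormalField φ) p]
    exact Metric.isOpen_ball.is_const_of_fderiv_eq_zero hpre
      (fun y hy => (hN y hy).differentiableAt.differentiableWithinAt)
      (fun y hy => (hN y hy).fderiv) hx hcenter
  have hφN : ∀ x ∈ Metric.ball (extChartAt (𝓡 n) p p) r,
      HasFDerivAt (fun y => minkForm (n + 1) (chartRepr φ p y) (normalizedNullNormalField φ p))
        (0 : EuclideanSpace ℝ (Fin n) →L[ℝ] ℝ) x := by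
    intro x hx
    have h1 := ((contDiffAt_chartRepr hφ.smooth p (hball hx)).differentiableAt
      (by simp)).hasFDerivAt
    have h2 := ((minkCLM (n + 1)).flip (normalizedNullNormalField φ p)).hasFDerivAt.comp x h1
    refine h2.congr_fderiv ?_
    ext1 v
    have h3 : fderiv ℝ (chartRepr φ p) x v ∈ imageTangent n φ ((extChartAt (𝓡 n) p).symm x) := by
      rw [← range_fderiv_chartRepr hφ.smooth p (hball hx)]
      exact ⟨v, rfl⟩
    rw [ContinuousLinearMap.comp_apply, ContinuousLinearMap.flip_apply, minkCLM_apply,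
      ← hconst x hx]
    have h4 : chartRepr (n := n) (normalizedNullNormalField φ) p x =
      (nullNormalField φ ((extChartAt (𝓡 n) p).symm x) (Fin.last (n + 1)))⁻¹ •
        nullNormalField φ ((extChartAt (𝓡 n) p).symm x) := rfl
    rw [h4, map_smul, (hξ _).orthogonal _ h3, smul_zero]
    rfl
  refine ⟨normalizedNullNormalField φ p, ?_, ?_, ?_⟩
  · simp [normalizedNullNormalField, hl p]
  · simp [normalizedNullNormalField, (hξ p).null]
  · filter_upwards [(continuousAt_extChartAt (I := 𝓡 n) p).eventually
      (Metric.isOpen_ball.mem_nhds hcenter), extChartAt_source_mem_nhds (I := 𝓡 n) p] with q hq hqs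
    constructor
    · have h1 := Metric.isOpen_ball.is_const_of_fderiv_eq_zero hpre
        (fun y hy => (hφN y hy).differentiableAt.differentiableWithinAt)
        (fun y hy => (hφN y hy).fderiv) hq hcenter
      rw [chartRepr_self] at h1
      simpa only [chartRepr, Function.comp_apply, (extChartAt (𝓡 n) p).left_inv hqs] using h1
    · have h1 := hconst _ hq
      simp only [chartRepr, Function.comp_apply, (extChartAt (𝓡 n) p).left_inv hqs] at h1
      rw [← h1, normalizedNullNormalField, map_smul, LinearMap.smul_apply, (hξ q).pairing]
      simpa using hl q

end NullNormalField

/-! ### Rotations of Minkowski space as products of two reflections. -/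

section Rotation

variable {n : ℕ}

theorem minkForm_single_zero (x : Fin (n + 1) → ℝ) :
    minkForm n x (Pi.single 0 1) = -x 0 := by
  simp [minkForm_apply]

/-- The reflection of Minkowski space in the hyperplane orthogonal to `u`. -/
noncomputable def minkReflection (u : Fin (n + 1) → ℝ) :
    (Fin (n + 1) → ℝ) →ₗ[ℝ] (Fin (n + 1) → ℝ) :=
  LinearMap.transvection ((-2 / minkForm n u u) • minkForm n u) u

theorem minkReflection_apply (u x : Fin (n + 1) → ℝ) :
    minkReflection u x = x + (-2 / minkForm n u u * minkForm n u x) • u := rfl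

theorem det_minkReflection {u : Fin (n + 1) → ℝ} (hu : minkForm n u u ≠ 0) :
    LinearMap.det (minkReflection u) = -1 := by
  rw [minkReflection, LinearMap.transvection.det, LinearMap.smul_apply, smul_eq_mul,
    div_mul_cancel₀ _ hu]
  norm_num

theorem minkForm_minkReflection {u : Fin (n + 1) → ℝ} (hu : minkForm n u u ≠ 0)
    (x y : Fin (n + 1) → ℝ) :
    minkForm n (minkReflection u x) (minkReflection u y) = minkForm n x y := by
  simp only [minkReflection_apply, map_add, map_smul, LinearMap.add_apply, LinearMap.smul_apply,
    smul_eq_mul, minkForm_comm n x u]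
  field_simp
  ring

/-- A future-directed unit time-like vector can be rotated to the time axis. -/
theorem exists_rotation {w : Fin (n + 1) → ℝ} (hw : minkForm n w w = -1) (hw0 : 0 < w 0) :
    ∃ Q : (Fin (n + 1) → ℝ) →ₗ[ℝ] (Fin (n + 1) → ℝ), IsMinkowskiRotation Q ∧
      Q w = Pi.single 0 1 := by
  set e : Fin (n + 1) → ℝ := Pi.single 0 1 with he
  have hee : minkForm n e e = -1 := by rw [he, minkForm_single_zero]; simp
  have hwe : minkForm n w e = -w 0 := minkForm_single_zero w
  have hew : minkForm n e w = -w 0 := by rw [minkForm_comm, hwe]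
  have huu : minkForm n (w + e) (w + e) = -2 - 2 * w 0 := by
    simp only [map_add, LinearMap.add_apply, hw, hee, hwe, hew]
    ring
  have hu0 : minkForm n (w + e) (w + e) ≠ 0 := by rw [huu]; linarith
  have he0 : minkForm n e e ≠ 0 := by rw [hee]; norm_num
  have hre : ∀ x, minkReflection e x = x + (2 * minkForm n e x) • e := by
    intro x
    rw [minkReflection_apply, hee]
    norm_num
  -- The reflection in w + e sends w to -e, and the reflection in e sends -e to e. Two reflections
  -- give determinant 1.
  have hQw : minkReflection e (minkReflection (w + e) w) = e := by
    have h1 : minkReflection (w + e) w = -e := by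
      rw [minkReflection_apply, huu]
      simp only [map_add, LinearMap.add_apply, hw, hew]
      have h2 : -2 / (-2 - 2 * w 0) * (-1 + -w 0) = -1 := by
        rw [div_mul_eq_mul_div, div_eq_iff (by linarith)]
        ring
      rw [h2]
      simp
    rw [h1, hre]
    simp only [map_neg, hee]
    module
  refine ⟨(minkReflection e).comp (minkReflection (w + e)), ⟨?_, ?_, ?_⟩, hQw⟩
  · intro x y
    rw [LinearMap.comp_apply, LinearMap.comp_apply, minkForm_minkReflection he0,
      minkForm_minkReflection hu0]
  · rw [LinearMap.det_comp, det_minkReflection he0, det_minkReflection hu0]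
    norm_num
  · have h1 : (minkReflection e ((minkReflection (w + e)) e)) 0 =
        minkForm n w e * (-1) := by
      -- Since Qw = e, ⟨Qe, e⟩ = ⟨Qe, Qw⟩ = ⟨e, w⟩, so the time coordinate of Qe is w₀ > 0.
      have h3 : minkForm n (minkReflection e (minkReflection (w + e) e)) e =
          minkForm n e w := by
        conv_lhs => arg 2; rw [← hQw]
        rw [minkForm_minkReflection he0, minkForm_minkReflection hu0]
      rw [he, minkForm_single_zero, ← he, hew] at h3
      rw [hwe]
      linarith
    rw [LinearMap.comp_apply, h1, hwe]
    linarith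

theorem IsMinkowskiRotation.injective {Q : (Fin (n + 1) → ℝ) →ₗ[ℝ] (Fin (n + 1) → ℝ)}
    (hQ : IsMinkowskiRotation Q) : Function.Injective Q := by
  rw [← LinearMap.ker_eq_bot, LinearMap.ker_eq_bot']
  intro x hx
  refine (minkForm_nondegenerate n).1 x fun y => ?_
  rw [← hQ.isometry, hx, map_zero, LinearMap.zero_apply]

end Rotation

/-! ### The model is isotropic. -/

section Backward

variable {n : ℕ} {M : Type*} [TopologicalSpace M] [ChartedSpace (EuclideanSpace ℝ (Fin n)) M]
  [IsManifold (𝓡 n) ∞ M] {φ : M → Fin (n + 2) → ℝ}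

theorem LocallyCongruentToModel.minkForm_secondFundamentalForm_eq_zero
    (hφ : IsNondegenerateImmersion n φ) (hLC : ∀ p, φ p ∈ lightHypercylinder n) {p : M}
    (h : LocallyCongruentToModel φ p) (v w : TangentSpace (𝓡 n) p) :
    minkForm (n + 1) (secondFundamentalForm hφ p v w) (secondFundamentalForm hφ p v w) = 0 := by
  obtain ⟨Q, ε, c₀, a, b, V, Θ, F, hQ, hε, -, hp, hsource, -, -, hF⟩ := h
  have hεε : ε * ε = 1 := by rcases hε with rfl | rfl <;> norm_num
  have hmodel : ∀ q ∈ F.target, ∃ s t, extendRotation Q (φ q) = modelPoint ε c₀ s (Θ t) := by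
    intro q hq
    have h1 := F.map_target hq
    rw [hsource] at h1
    refine ⟨(F.symm q).1, (F.symm q).2, ?_⟩
    rw [← hF _ h1.1 _ h1.2, Prod.mk.eta, F.right_inv hq]
  obtain ⟨e, he⟩ := LinearMap.injective_iff_surjective.1 hQ.injective (Pi.single 0 1)
  have hee : minkForm n e e = -1 := by
    rw [← hQ.isometry, he, minkForm_single_zero]
    simp
  have hform : ∀ y : Fin (n + 1) → ℝ, minkForm n y e = -(Q y 0) := fun y => by
    rw [← hQ.isometry, he, minkForm_single_zero]
  have hinit : ∀ q ∈ F.target, (Q (Fin.init (φ q)) : Fin (n + 1) → ℝ) 0 =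
      ε * φ q (Fin.last (n + 1)) + c₀ ∧ (Q (Fin.init (φ q)) : Fin (n + 1) → ℝ) 0 ≠ 0 := by
    intro q hq
    obtain ⟨s, t, hst⟩ := hmodel q hq
    have h1 : (Q (Fin.init (φ q)) : Fin (n + 1) → ℝ) =
        Fin.cons (ε * s + c₀) fun i : Fin n => (ε * s + c₀) * Θ t i := by
      have := congrArg (fun x : Fin (n + 2) → ℝ => (Fin.init x : Fin (n + 1) → ℝ)) hst
      simpa [extendRotation, modelPoint] using this
    have h2 : φ q (Fin.last (n + 1)) = s := by
      have := congrFun hst (Fin.last (n + 1))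
      simpa [extendRotation, modelPoint] using this
    refine ⟨by rw [h1, h2, Fin.cons_zero], ?_⟩
    rw [h1, Fin.cons_zero]
    intro h0
    have h3 : (Q (Fin.init (φ q)) : Fin (n + 1) → ℝ) = 0 := by
      rw [h1, h0]
      funext i
      refine Fin.cases ?_ (fun j => ?_) i <;> simp
    have h4 : (Fin.init (φ q) : Fin (n + 1) → ℝ) = 0 := hQ.injective (by rw [h3, map_zero])
    have h5 := (hLC q).2
    rw [h4] at h5
    exact lt_irrefl _ h5
  -- With Qe the time axis, ⟨φ, N⟩ = -(ε s + c₀) + ε s = -c₀, and ⟨N, N⟩ = -1 + ε² = 0.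
  let N : Fin (n + 2) → ℝ := Fin.snoc (α := fun _ => ℝ) e ε
  have hNinit : (Fin.init N : Fin (n + 1) → ℝ) = e := Fin.init_snoc _ _
  have hNlast : N (Fin.last (n + 1)) = ε := Fin.snoc_last _ _
  refine _root_.minkForm_secondFundamentalForm_eq_zero hφ hLC (N := N) (c := -c₀) ?_ ?_ ?_ v w
  · rw [minkForm_eq_init_add_last, hNinit, hNlast, hee, hεε]
    norm_num
  · rw [minkForm_coneNormal, hNinit, minkForm_comm, hform]
    exact neg_ne_zero.2 (hinit p hp).2
  · filter_upwards [F.open_target.mem_nhds hp] with q hq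
    rw [minkForm_eq_init_add_last, hNinit, hNlast, hform, (hinit q hq).1]
    ring

end Backward

/-! ### Adapted coordinates -/

/-- A local parametrization `Θ` of the unit sphere around `θ₀`, with a smooth retraction `σ`. -/
theorem exists_sphere_parametrization {n : ℕ} (hn : 1 ≤ n) {θ₀ : EuclideanSpace ℝ (Fin n)}
    (hθ₀ : ‖θ₀‖ = 1) :
    ∃ (Θ : EuclideanSpace ℝ (Fin (n - 1)) → EuclideanSpace ℝ (Fin n))
      (σ : EuclideanSpace ℝ (Fin n) → EuclideanSpace ℝ (Fin (n - 1)))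
      (O : Set (EuclideanSpace ℝ (Fin n))), IsOpen O ∧ θ₀ ∈ O ∧ ContDiff ℝ ∞ Θ ∧
      ContDiffOn ℝ ∞ σ O ∧ (∀ t, ‖Θ t‖ = 1 ∧ Θ t ∈ O ∧ σ (Θ t) = t) ∧
      ∀ θ ∈ O, ‖θ‖ = 1 → Θ (σ θ) = θ := by
  have : Fact (Module.finrank ℝ (EuclideanSpace ℝ (Fin n)) = (n - 1) + 1) :=
    ⟨by rw [finrank_euclideanSpace_fin]; omega⟩
  -- Stereographic projection from the antipode of θ₀. Its formula is smooth on the open set ⟨v, θ⟩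
  -- ≠ 1 of the ambient space, which contains θ₀.
  set v : EuclideanSpace ℝ (Fin n) := -θ₀ with hv
  have hv1 : ‖v‖ = 1 := by rw [hv, norm_neg, hθ₀]
  have hv0 : v ≠ 0 := by
    intro h
    rw [h, norm_zero] at hv1
    exact zero_ne_one hv1
  let U := (OrthonormalBasis.fromOrthogonalSpanSingleton (𝕜 := ℝ) (n - 1) hv0).repr
  have hne : ∀ θ : EuclideanSpace ℝ (Fin n), ‖θ‖ = 1 → (innerSL ℝ v θ ≠ (1 : ℝ) ↔ θ ≠ v) := by
    intro θ hθ
    rw [innerSL_apply_apply, Ne, inner_eq_one_iff_of_norm_eq_one hv1 hθ, eq_comm]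
  refine ⟨fun t => stereoInvFun hv1 (U.symm t), fun θ => U (stereoToFun v θ),
    {θ | innerSL ℝ v θ ≠ (1 : ℝ)}, ?_, ?_, ?_, ?_, ?_, ?_⟩
  · exact isOpen_ne_fun (innerSL ℝ v).continuous continuous_const
  · change innerSL ℝ v θ₀ ≠ 1
    rw [innerSL_apply_apply, hv, inner_neg_left, real_inner_self_eq_norm_sq, hθ₀]
    norm_num
  · exact (contDiff_stereoInvFunAux (v := v)).comp
      ((ℝ ∙ v)ᗮ.subtypeL.contDiff.comp U.symm.contDiff)
  · exact U.contDiff.comp_contDiffOn contDiffOn_stereoToFun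
  · intro t
    have h1 : ‖(stereoInvFun hv1 (U.symm t) : EuclideanSpace ℝ (Fin n))‖ = 1 :=
      mem_sphere_zero_iff_norm.1 (stereoInvFun hv1 (U.symm t)).2
    refine ⟨h1, ?_, ?_⟩
    · rw [Set.mem_ofPred_eq, hne _ h1]
      exact fun h => stereoInvFun_ne_north_pole hv1 (U.symm t) (Subtype.ext h)
    · change U (stereoToFun v (stereoInvFun hv1 (U.symm t))) = t
      rw [stereo_right_inv hv1, LinearIsometryEquiv.apply_symm_apply]
  · intro θ hθ hθ1
    rw [Set.mem_ofPred_eq, hne _ hθ1] at hθ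
    have h1 := stereo_left_inv hv1 (x := ⟨θ, mem_sphere_zero_iff_norm.2 hθ1⟩) hθ
    change (stereoInvFun hv1 (U.symm (U (stereoToFun v θ))) : EuclideanSpace ℝ (Fin n)) = θ
    rw [LinearIsometryEquiv.symm_apply_apply]
    exact congrArg Subtype.val h1

/-- From σ ∘ Θ = id, both Θ and, by the chain rule, its differential are injective. -/
theorem isSphereParametrization_of_leftInverse {n : ℕ}
    {Θ : EuclideanSpace ℝ (Fin (n - 1)) → EuclideanSpace ℝ (Fin n)}
    {σ : EuclideanSpace ℝ (Fin n) → EuclideanSpace ℝ (Fin (n - 1))}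
    {O : Set (EuclideanSpace ℝ (Fin n))} (hO : IsOpen O) (hΘ : ContDiff ℝ ∞ Θ)
    (hσ : ContDiffOn ℝ ∞ σ O) (h : ∀ t, ‖Θ t‖ = 1 ∧ Θ t ∈ O ∧ σ (Θ t) = t)
    {V : Set (EuclideanSpace ℝ (Fin (n - 1)))} (hV : IsOpen V) :
    IsSphereParametrization V Θ := by
  refine ⟨hV, hΘ.contDiffOn, fun s _ t _ hst => ?_, fun t _ => ?_,
    fun t _ => mem_sphere_zero_iff_norm.2 (h t).1⟩
  · rw [← (h s).2.2, ← (h t).2.2, hst]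
  · have h1 := ((hσ.contDiffAt (hO.mem_nhds (h t).2.1)).differentiableAt (by simp)).hasFDerivAt
    have h2 := (hΘ.contDiffAt.differentiableAt (by simp) (x := t)).hasFDerivAt
    have h3 := h1.comp t h2
    have h4 : σ ∘ Θ = id := funext fun t => (h t).2.2
    rw [h4] at h3
    have h5 := h3.unique (hasFDerivAt_id t)
    intro v w hvw
    have h6 := congrArg (fun A => A v) h5
    have h7 := congrArg (fun A => A w) h5
    simp only [ContinuousLinearMap.comp_apply, ContinuousLinearMap.id_apply] at h6 h7
    rw [← h6, ← h7, hvw]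

/-- A smooth map with injective differential from a chart domain to a space of the same dimension
gives local coordinates, ranging over a product of balls. -/
theorem exists_coordinates {n : ℕ} (hn : 1 ≤ n) {M : Type*} [TopologicalSpace M]
    [ChartedSpace (EuclideanSpace ℝ (Fin n)) M] [IsManifold (𝓡 n) ∞ M] (p : M)
    {H : EuclideanSpace ℝ (Fin n) → ℝ × EuclideanSpace ℝ (Fin (n - 1))}
    {W : Set (EuclideanSpace ℝ (Fin n))} (hW : IsOpen W) (hpW : extChartAt (𝓡 n) p p ∈ W)
    (hH : ∀ x ∈ W, ContDiffAt ℝ ∞ H x) (hinj : ∀ x ∈ W, Function.Injective (fderiv ℝ H x)) :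
    ∃ (a b : ℝ) (V : Set (EuclideanSpace ℝ (Fin (n - 1))))
      (F : OpenPartialHomeomorph (ℝ × EuclideanSpace ℝ (Fin (n - 1))) M),
      IsOpen V ∧ p ∈ F.target ∧ F.source = Set.Ioo a b ×ˢ V ∧
      ContMDiffOn 𝓘(ℝ, ℝ × EuclideanSpace ℝ (Fin (n - 1))) (𝓡 n) ∞ F F.source ∧
      ContMDiffOn (𝓡 n) 𝓘(ℝ, ℝ × EuclideanSpace ℝ (Fin (n - 1))) ∞ F.symm F.target ∧
      ∀ z ∈ F.source, ∃ x ∈ W, F z = (extChartAt (𝓡 n) p).symm x ∧ H x = z := by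
  have hdim : Module.finrank ℝ (EuclideanSpace ℝ (Fin n)) =
      Module.finrank ℝ (ℝ × EuclideanSpace ℝ (Fin (n - 1))) := by
    simp
    omega
  have hequiv : ∀ x ∈ W, ∃ e : EuclideanSpace ℝ (Fin n) ≃L[ℝ] ℝ × EuclideanSpace ℝ (Fin (n - 1)),
      HasFDerivAt H (e : _ →L[ℝ] _) x := by
    intro x hx
    refine ⟨(LinearEquiv.ofInjectiveOfFinrankEq (fderiv ℝ H x).toLinearMap (hinj x hx)
      hdim).toContinuousLinearEquiv, ?_⟩
    refine ((hH x hx).differentiableAt (by simp)).hasFDerivAt.congr_fderiv ?_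
    ext1 u
    rfl
  obtain ⟨e, he⟩ := hequiv _ hpW
  let e₀ := (hH _ hpW).toOpenPartialHomeomorph H he (by simp)
  let e₁ := e₀.restrOpen W hW
  have he₁ : ∀ x, e₁ x = H x := fun x => rfl
  have he₁s : e₁.source = e₀.source ∩ W := e₀.restrOpen_source W hW
  set x₀ := extChartAt (𝓡 n) p p with hx₀
  have hx₀s : x₀ ∈ e₁.source := by
    rw [he₁s]
    exact ⟨(hH _ hpW).mem_toOpenPartialHomeomorph_source he (by simp), hpW⟩
  let c := chartAt (EuclideanSpace ℝ (Fin n)) p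
  have hx₀c : x₀ ∈ c.target := mem_chart_target _ p
  have hcx₀ : c.symm x₀ = p := c.left_inv (mem_chart_source _ p)
  have hct : c.target = (extChartAt (𝓡 n) p).target := by simp [c]
  let G := e₁.symm.trans c.symm
  have hGs : G.source = e₁.target ∩ e₁.symm ⁻¹' c.target := rfl
  have hz₀ : H x₀ ∈ G.source := by
    refine ⟨e₁.map_source hx₀s, ?_⟩
    change e₁.symm (e₁ x₀) ∈ c.target
    rw [e₁.left_inv hx₀s]
    exact hx₀c
  -- In the sup metric of the product a ball is an interval times a ball, which is the required
  -- shape of the source.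
  obtain ⟨r, hr, hball⟩ := Metric.isOpen_iff.1 G.open_source _ hz₀
  let F := G.restrOpen (Metric.ball (H x₀) r) Metric.isOpen_ball
  have hFs : F.source = Metric.ball (H x₀) r := by
    rw [G.restrOpen_source]
    exact Set.inter_eq_right.2 hball
  have hFG : F.source ⊆ G.source := hFs.trans_subset hball
  have hFa : ∀ z, F z = (extChartAt (𝓡 n) p).symm (e₁.symm z) := fun z => rfl
  have hx : ∀ z ∈ F.source, e₁.symm z ∈ W ∧ H (e₁.symm z) = z := by
    intro z hz
    have h1 := (hFG hz).1
    have h2 := e₁.map_target h1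
    rw [he₁s] at h2
    exact ⟨h2.2, e₁.right_inv h1⟩
  refine ⟨(H x₀).1 - r, (H x₀).1 + r, Metric.ball (H x₀).2 r, F, Metric.isOpen_ball, ?_, ?_, ?_, ?_,
    fun z hz => ⟨e₁.symm z, (hx z hz).1, hFa z, (hx z hz).2⟩⟩
  · have h1 : F (H x₀) = p := by
      change c.symm (e₁.symm (e₁ x₀)) = p
      rw [e₁.left_inv hx₀s, hcx₀]
    rw [← h1]
    exact F.map_source (by rw [hFs]; exact Metric.mem_ball_self hr)
  · rw [hFs, ← Real.ball_eq_Ioo, ball_prod_same]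
  · intro z hz
    obtain ⟨e', he'⟩ := hequiv _ (hx z hz).1
    have h1 : ContDiffAt ℝ ∞ e₁.symm z :=
      e₁.contDiffAt_symm (hFG hz).1 he' (hH _ (hx z hz).1)
    have h2 : e₁.symm z ∈ (extChartAt (𝓡 n) p).target := hct ▸ (hFG hz).2
    have h3 := (contMDiffOn_extChartAt_symm (n := ∞) (I := 𝓡 n) p).contMDiffAt
      ((isOpen_extChartAt_target (I := 𝓡 n) p).mem_nhds h2)
    exact (h3.comp z h1.contMDiffAt).contMDiffWithinAt
  · intro q hq
    have h1 := F.map_target hq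
    have h2 := hFG h1
    have h3 : F.symm q = H (extChartAt (𝓡 n) p q) := rfl
    have hqF : q = c.symm (e₁.symm (F.symm q)) := (F.right_inv hq).symm
    have hqs : q ∈ c.source := by
      rw [hqF]
      exact c.map_target h2.2
    have hqW : extChartAt (𝓡 n) p q ∈ W := by
      have h4 : c q = e₁.symm (F.symm q) := by
        conv_lhs => rw [hqF]
        exact c.right_inv h2.2
      change c q ∈ W
      rw [h4]
      exact (hx _ h1).1
    have h5 : ContMDiffAt (𝓡 n) 𝓘(ℝ, EuclideanSpace ℝ (Fin n)) ∞ (extChartAt (𝓡 n) p) q :=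
      contMDiffAt_extChartAt' hqs
    exact ((hH _ hqW).contMDiffAt.comp q h5).contMDiffWithinAt

section AdaptedCoordinates

variable {n : ℕ}

/-- The linear map `x ↦ Q (x₁, …, x_{n+1})`. -/
noncomputable def rotatedInit (Q : (Fin (n + 1) → ℝ) →ₗ[ℝ] (Fin (n + 1) → ℝ)) :
    (Fin (n + 2) → ℝ) →L[ℝ] (Fin (n + 1) → ℝ) :=
  (Q.comp (LinearMap.pi fun i : Fin (n + 1) =>
    (LinearMap.proj i.castSucc : (Fin (n + 2) → ℝ) →ₗ[ℝ] ℝ))).toContinuousLinearMap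

theorem rotatedInit_apply (Q : (Fin (n + 1) → ℝ) →ₗ[ℝ] (Fin (n + 1) → ℝ)) (x : Fin (n + 2) → ℝ) :
    rotatedInit Q x = Q (Fin.init x) := rfl

/-- The spherical component of the rotated point. -/
noncomputable def sphericalPart (Q : (Fin (n + 1) → ℝ) →ₗ[ℝ] (Fin (n + 1) → ℝ))
    (x : Fin (n + 2) → ℝ) : EuclideanSpace ℝ (Fin n) :=
  (rotatedInit Q x 0)⁻¹ • WithLp.toLp 2 fun i : Fin n => rotatedInit Q x i.succ

theorem contDiffAt_sphericalPart (Q : (Fin (n + 1) → ℝ) →ₗ[ℝ] (Fin (n + 1) → ℝ))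
    {x : Fin (n + 2) → ℝ} (hx : rotatedInit Q x 0 ≠ 0) :
    ContDiffAt ℝ ∞ (sphericalPart Q) x := by
  have h1 : ∀ i, ContDiffAt ℝ ∞ (fun y => rotatedInit Q y i) x := fun i =>
    ((ContinuousLinearMap.proj (R := ℝ) (φ := fun _ : Fin (n + 1) => ℝ) i).comp
      (rotatedInit Q)).contDiff.contDiffAt
  refine ((h1 0).inv hx).smul ?_
  rw [contDiffAt_piLp]
  exact fun i => h1 i.succ

/-- The rotated vector is still null, so its spatial part has length |y₀|. -/
theorem norm_sphericalPart {Q : (Fin (n + 1) → ℝ) →ₗ[ℝ] (Fin (n + 1) → ℝ)}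
    (hQ : IsMinkowskiRotation Q) {x : Fin (n + 2) → ℝ} (hx : x ∈ lightHypercylinder n)
    (h0 : rotatedInit Q x 0 ≠ 0) : ‖sphericalPart Q x‖ = 1 := by
  have h1 := hQ.isometry (Fin.init x) (Fin.init x)
  rw [hx.1, ← rotatedInit_apply, minkForm_apply] at h1
  have h2 : ‖sphericalPart Q x‖ ^ 2 = 1 := by
    rw [EuclideanSpace.norm_sq_eq]
    simp only [sphericalPart, PiLp.smul_apply, smul_eq_mul, norm_mul, mul_pow, Real.norm_eq_abs,
      sq_abs, ← Finset.mul_sum]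
    rw [inv_pow, inv_mul_eq_one₀ (pow_ne_zero 2 h0)]
    simp only [pow_two]
    linarith
  nlinarith [norm_nonneg (sphericalPart Q x)]

theorem extendRotation_eq_modelPoint (Q : (Fin (n + 1) → ℝ) →ₗ[ℝ] (Fin (n + 1) → ℝ))
    {ε c₀ : ℝ} {x : Fin (n + 2) → ℝ} (h0 : rotatedInit Q x 0 ≠ 0)
    (h : rotatedInit Q x 0 = ε * x (Fin.last (n + 1)) + c₀) :
    extendRotation Q x = modelPoint ε c₀ (x (Fin.last (n + 1))) (sphericalPart Q x) := by
  have h1 : Q (Fin.init x) = (Fin.cons (ε * x (Fin.last (n + 1)) + c₀)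
      fun i : Fin n => (ε * x (Fin.last (n + 1)) + c₀) * sphericalPart Q x i : Fin (n + 1) → ℝ) := by
    rw [← rotatedInit_apply, ← h]
    funext i
    refine Fin.cases ?_ (fun j => ?_) i
    · rw [Fin.cons_zero]
    · rw [Fin.cons_succ, sphericalPart]
      simp [h0]
  rw [extendRotation, modelPoint, h1]

theorem eq_zero_of_rotatedInit_eq_zero {Q : (Fin (n + 1) → ℝ) →ₗ[ℝ] (Fin (n + 1) → ℝ)}
    (hQ : IsMinkowskiRotation Q) {x : Fin (n + 2) → ℝ} (h1 : rotatedInit Q x = 0)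
    (h2 : x (Fin.last (n + 1)) = 0) : x = 0 := by
  rw [rotatedInit_apply] at h1
  have h3 : (Fin.init x : Fin (n + 1) → ℝ) = 0 := hQ.injective (by rw [h1, map_zero])
  funext i
  refine Fin.lastCases ?_ (fun j => ?_) i
  · exact h2
  · exact congrFun h3 j

/-- If the time coordinate is locally, after a rotation, an affine function `ε x_{n+2} + c₀`, then the
submanifold is locally congruent to the model. -/
theorem locallyCongruentToModel_of_eventually (hn : 1 ≤ n) {M : Type*} [TopologicalSpace M]
    [ChartedSpace (EuclideanSpace ℝ (Fin n)) M] [IsManifold (𝓡 n) ∞ M] {φ : M → Fin (n + 2) → ℝ}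
    (hφ : IsNondegenerateImmersion n φ) (hLC : ∀ p, φ p ∈ lightHypercylinder n)
    {Q : (Fin (n + 1) → ℝ) →ₗ[ℝ] (Fin (n + 1) → ℝ)} (hQ : IsMinkowskiRotation Q)
    {ε c₀ : ℝ} (hε : ε = 1 ∨ ε = -1) {p : M}
    (h : ∀ᶠ q in 𝓝 p, rotatedInit Q (φ q) 0 ≠ 0 ∧
      rotatedInit Q (φ q) 0 = ε * φ q (Fin.last (n + 1)) + c₀) :
    LocallyCongruentToModel φ p := by
  obtain ⟨Θ, σ, O, hO, hpO, hΘ, hσ, hΘσ, hσΘ⟩ := exists_sphere_parametrization hn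
    (norm_sphericalPart hQ (hLC p) h.self_of_nhds.1)
  let Y : (Fin (n + 2) → ℝ) → ℝ × EuclideanSpace ℝ (Fin (n - 1)) :=
    fun x => (x (Fin.last (n + 1)), σ (sphericalPart Q x))
  have hev : ∀ᶠ q in 𝓝 p, (rotatedInit Q (φ q) 0 ≠ 0 ∧
      rotatedInit Q (φ q) 0 = ε * φ q (Fin.last (n + 1)) + c₀) ∧ sphericalPart Q (φ q) ∈ O := by
    have h1 : ContinuousAt (fun q => sphericalPart Q (φ q)) p :=
      ContinuousAt.comp (g := sphericalPart Q)
        (contDiffAt_sphericalPart Q h.self_of_nhds.1).continuousAt hφ.smooth.continuous.continuousAt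
    exact h.and (h1.eventually (hO.mem_nhds hpO))
  obtain ⟨W, hWsub, hW, hpW⟩ := mem_nhds_iff.1 ((eventually_extChartAt_symm (n := n) hev).and
    ((isOpen_extChartAt_target (I := 𝓡 n) p).mem_nhds (mem_extChartAt_target (I := 𝓡 n) p)))
  have hmodel : ∀ x ∈ W, extendRotation Q (chartRepr φ p x) =
      modelPoint ε c₀ (Y (chartRepr φ p x)).1 (Θ (Y (chartRepr φ p x)).2) := by
    intro x hx
    obtain ⟨⟨⟨h0, h1⟩, h2⟩, -⟩ := hWsub hx
    exact (extendRotation_eq_modelPoint Q h0 h1).trans (congrArg (modelPoint ε c₀ _)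
      (hσΘ _ h2 (norm_sphericalPart hQ (hLC _) h0)).symm)
  have hH : ∀ x ∈ W, ContDiffAt ℝ ∞ (Y ∘ chartRepr φ p) x := by
    intro x hx
    obtain ⟨⟨⟨h0, h1⟩, h2⟩, h3⟩ := hWsub hx
    refine ContDiffAt.comp x ?_ (contDiffAt_chartRepr hφ.smooth p h3)
    refine ContDiffAt.prodMk ?_ ?_
    · exact (ContinuousLinearMap.proj (R := ℝ) (φ := fun _ : Fin (n + 2) => ℝ)
        (Fin.last (n + 1))).contDiff.contDiffAt
    · exact (hσ.contDiffAt (hO.mem_nhds h2)).comp _ (contDiffAt_sphericalPart Q h0)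
  -- By `hmodel` the rotated φ factors differentiably through Y ∘ φ, so a vector killed by d(Y ∘ φ)
  -- is killed by dφ.
  have hinj : ∀ x ∈ W, Function.Injective (fderiv ℝ (Y ∘ chartRepr φ p) x) := by
    intro x hx
    obtain ⟨⟨⟨h0, h1⟩, h2⟩, h3⟩ := hWsub hx
    have hg := ((contDiffAt_chartRepr hφ.smooth p h3).differentiableAt (by simp)).hasFDerivAt
    have hYd := ((hH x hx).differentiableAt (by simp)).hasFDerivAt
    have hginj : Function.Injective (fderiv ℝ (chartRepr φ p) x) := by
      obtain ⟨e, he⟩ := fderiv_chartRepr hφ.smooth p h3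
      rw [he]
      exact (hφ.injective _).comp e.injective
    refine (injective_iff_map_eq_zero _).2 fun v hv => hginj ?_
    rw [map_zero]
    have hΘd := (hΘ.differentiable (by simp) (Y (chartRepr φ p x)).2).hasFDerivAt
    have hcoord : ∀ i : Fin (n + 2), ∃ P : ℝ × EuclideanSpace ℝ (Fin (n - 1)) → ℝ,
        DifferentiableAt ℝ P (Y (chartRepr φ p x)) ∧
        ∀ y ∈ W, extendRotation Q (chartRepr φ p y) i = P (Y (chartRepr φ p y)) := by
      intro i
      refine ⟨fun z => modelPoint ε c₀ z.1 (Θ z.2) i, ?_, fun y hy => congrFun (hmodel y hy) i⟩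
      have hΘi : ∀ k : Fin n, DifferentiableAt ℝ
          (fun z : ℝ × EuclideanSpace ℝ (Fin (n - 1)) => Θ z.2 k) (Y (chartRepr φ p x)) := by
        intro k
        exact (EuclideanSpace.proj k : EuclideanSpace ℝ (Fin n) →L[ℝ] ℝ).differentiableAt.comp _
          ((hΘ.differentiable (by simp)).differentiableAt.comp _ differentiableAt_snd)
      refine Fin.lastCases ?_ (fun j => ?_) i
      · simp only [modelPoint, Fin.snoc_last]
        exact differentiableAt_fst
      · simp only [modelPoint, Fin.snoc_castSucc]
        refine Fin.cases ?_ (fun k => ?_) j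
        · simp only [Fin.cons_zero]
          exact (differentiableAt_fst.const_mul _).add_const _
        · simp only [Fin.cons_succ]
          exact ((differentiableAt_fst.const_mul _).add_const _).mul (hΘi k)
    have hzero : ∀ (i : Fin (n + 2)) (B : (Fin (n + 2) → ℝ) →L[ℝ] ℝ),
        (∀ y, B y = extendRotation Q y i) → B (fderiv ℝ (chartRepr φ p) x v) = 0 := by
      intro i B hB
      obtain ⟨P, hP, hPW⟩ := hcoord i
      have hd1 := B.hasFDerivAt.comp x hg
      have hd2 := HasFDerivAt.comp (f := Y ∘ chartRepr φ p) x hP.hasFDerivAt hYd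
      have hd3 := hd2.congr_of_eventuallyEq (f₁ := B ∘ chartRepr φ p) (by
        filter_upwards [hW.mem_nhds hx] with y hy
        simp only [Function.comp_apply]
        rw [hB, hPW y hy])
      have := congrArg (fun A => A v) (hd1.unique hd3)
      simpa [hv] using this
    refine eq_zero_of_rotatedInit_eq_zero hQ (funext fun i => ?_) ?_
    · exact hzero i.castSucc ((ContinuousLinearMap.proj (R := ℝ) (φ := fun _ : Fin (n + 1) => ℝ)
        i).comp (rotatedInit Q)) fun y => by simp [extendRotation, rotatedInit_apply]
    · exact hzero (Fin.last (n + 1)) (ContinuousLinearMap.proj (R := ℝ)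
        (φ := fun _ : Fin (n + 2) => ℝ) (Fin.last (n + 1))) fun y => by simp [extendRotation]
  obtain ⟨a, b, V, F, hV, hpF, hFs, hF1, hF2, hF3⟩ := exists_coordinates hn p hW hpW hH hinj
  refine ⟨Q, ε, c₀, a, b, V, Θ, F, hQ, hε, isSphereParametrization_of_leftInverse hO hΘ hσ hΘσ hV,
    hpF, hFs, hF1, hF2, fun s hs t ht => ?_⟩
  obtain ⟨x, hx, hFx, hHx⟩ := hF3 (s, t) (by rw [hFs]; exact ⟨hs, ht⟩)
  have h1 := hmodel x hx
  rw [Function.comp_apply] at hHx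
  rw [hHx] at h1
  rw [hFx]
  exact h1

end AdaptedCoordinates

/-! ### From the constant null normal to the model, and the equivalence. -/

theorem locallyCongruentToModel_of_isotropic {n : ℕ} (hn : 2 ≤ n) {M : Type*} [TopologicalSpace M]
    [ChartedSpace (EuclideanSpace ℝ (Fin n)) M] [IsManifold (𝓡 n) ∞ M] {φ : M → Fin (n + 2) → ℝ}
    (hφ : IsNondegenerateImmersion n φ) (hLC : ∀ p, φ p ∈ lightHypercylinder n)
    (hα : ∀ p, lastDirection n ∉ imageTangent n φ p) {lam : M → ℝ}
    (hiso : IsIsotropicImmersion hφ lam) (p : M) : LocallyCongruentToModel φ p := by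
  obtain ⟨N, hN1, hN2, hN⟩ := exists_const_null_normal hn hφ hLC hα hiso p
  set w : Fin (n + 1) → ℝ := Fin.init N with hw
  set c := minkForm (n + 1) (φ p) N with hc
  have hww : minkForm n w w = -1 := by
    rw [minkForm_eq_init_add_last, hN1, ← hw] at hN2
    linarith
  have hw0 : w 0 ≠ 0 := by
    intro h0
    rw [minkForm_apply, h0] at hww
    have : 0 ≤ ∑ i : Fin n, w i.succ * w i.succ := Finset.sum_nonneg fun i _ => mul_self_nonneg _
    linarith
  have hyw : ∀ᶠ q in 𝓝 p, minkForm n (Fin.init (φ q)) w = c - φ q (Fin.last (n + 1)) ∧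
      minkForm n (Fin.init (φ q)) w ≠ 0 := by
    filter_upwards [hN] with q hq
    rw [minkForm_eq_init_add_last, hN1, ← hw, minkForm_coneNormal, ← hw,
      minkForm_comm n w] at hq
    exact ⟨by linarith [hq.1], hq.2⟩
  have hrot : ∀ {w' : Fin (n + 1) → ℝ} {Q : (Fin (n + 1) → ℝ) →ₗ[ℝ] (Fin (n + 1) → ℝ)},
      IsMinkowskiRotation Q → Q w' = Pi.single 0 1 → ∀ x : Fin (n + 2) → ℝ,
        rotatedInit Q x 0 = -minkForm n (Fin.init x) w' := by
    intro w' Q hQ hQw x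
    rw [← hQ.isometry, hQw, minkForm_single_zero, neg_neg, rotatedInit_apply]
  -- Only a future-directed vector can be rotated to the time axis. A past-directed w is replaced by
  -- -w, so ε is the sign of w₀; c₀ comes from solving ⟨φ, N⟩ = c for the rotated time coordinate.
  rcases hw0.lt_or_gt with hneg | hpos
  · obtain ⟨Q, hQ, hQw⟩ := exists_rotation (w := -w) (by simp [hww]) (by simpa using hneg)
    refine locallyCongruentToModel_of_eventually (by omega) hφ hLC hQ (ε := -1) (c₀ := c)
      (Or.inr rfl) ?_
    filter_upwards [hyw] with q hq
    rw [hrot hQ hQw, map_neg, neg_neg]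
    exact ⟨hq.2, by rw [hq.1]; ring⟩
  · obtain ⟨Q, hQ, hQw⟩ := exists_rotation hww hpos
    refine locallyCongruentToModel_of_eventually (by omega) hφ hLC hQ (ε := 1) (c₀ := -c)
      (Or.inl rfl) ?_
    filter_upwards [hyw] with q hq
    rw [hrot hQ hQw]
    exact ⟨neg_ne_zero.2 hq.2, by rw [hq.1]; ring⟩

theorem mainTheorem2 (n : ℕ) (hn : 2 < n)
    {M : Type*} [TopologicalSpace M] [ChartedSpace (EuclideanSpace ℝ (Fin n)) M]
    [IsManifold (𝓡 n) ∞ M]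
    (φ : M → Fin (n + 2) → ℝ) (hφ : IsNondegenerateImmersion n φ)
    (hLC : ∀ p, φ p ∈ lightHypercylinder n)
    (hα : ∀ p, lastDirection n ∉ imageTangent n φ p) :
    (∃ lam : M → ℝ, IsIsotropicImmersion hφ lam) ↔
      ∀ p : M, LocallyCongruentToModel φ p := by
  constructor
  · rintro ⟨lam, hiso⟩ p
    exact locallyCongruentToModel_of_isotropic hn.le hφ hLC hα hiso p
  · intro h
    exact ⟨fun _ => 0, contMDiff_const, fun p X _ =>
      (h p).minkForm_secondFundamentalForm_eq_zero hφ hLC X X⟩
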